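/- Let $n\ge 1$. For $v\in\mathbb R^n$ and a real symmetric $n\times n$ matrix $b$, consider the co-evolution system $$V'(t)=W(t)V(t),\qquad W'(t)=V(t)V(t)^T,\qquad V(0)=v,\quad W(0)=b,$$ for $V(t)\in\mathbb R^n$ and $W(t)=[w_{ij}(t)]\in\mathbb R^{n\times n}$, and let $[0,T)$ with $0<T\le+\infty$ be the maximal interval of existence of its solution. Then for generic initial data $(v,b)$, that is, for all $(v,b)$ outside a set that is nowhere dense and has Lebesgue measure zero in the space of pairs (vector, symmetric matrix), at least one of the following holds: 1. (strict structural balance) for all indices $i,j,k$ (not necessarily distinct) the limit $\lim_{t\to T}w_{ij}(t)\,w_{jk}(t)\,w_{ki}(t)$ exists in $[-\infty,+\infty]$ and is $>0$ (possibly $+\infty$); 2. $T=+\infty$, $\lim_{t\to\infty}|V(t)|=0$ and $\lim_{t\to\infty}V'(t)=0$. Furthermore, for these initial data, whenever 1 holds the normalized opinion vector $V(t)/|V(t)|$ converges, as $t\to T$, to a unit vector. Here $|\cdot|$ is the Euclidean norm. -/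

import Mathlib

open Filter Topology MeasureTheory Matrix

namespace CoEvolution

/-- The space of initial data `(V(0), W(0))` with `W(0)` symmetric. A symmetric matrix is recorded
by its entries, one for each unordered pair of indices, so that the space carries its usual
topology and the Lebesgue measure in the coordinates `v_i` and `w_ij`, `i ≤ j`. -/
abbrev InitialData (n : ℕ) : Type := EuclideanSpace ℝ (Fin n) × (Sym2 (Fin n) → ℝ)

/-- The symmetric matrix with the entries `b s(i, j)`. -/
def symMatrix {n : ℕ} (b : Sym2 (Fin n) → ℝ) : Matrix (Fin n) (Fin n) ℝ :=
  Matrix.of fun i j => b s(i, j)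

/-- The half-open time interval `[0, T)`, for an end point `T` that may be `+∞`. -/
def timeInterval (T : EReal) : Set ℝ := {t | 0 ≤ t ∧ (t : EReal) < T}

/-- The filter `t → T`, `t < T`, on real times: the left neighbourhoods of `T` for a real `T`,
and `atTop` for `T = +∞`. -/
noncomputable def timeTo (T : EReal) : Filter ℝ := comap (fun t : ℝ => (t : EReal)) (𝓝[<] T)

/-- `(V, W)` solves `V' = W V`, `W' = V Vᵀ` (entry by entry) on `[0, T)` with the initial values
`v` and `b`; the derivative at `t = 0` is one-sided. Values outside `[0, T)` are irrelevant. -/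
structure IsSolution {n : ℕ} (v : EuclideanSpace ℝ (Fin n)) (b : Matrix (Fin n) (Fin n) ℝ)
    (T : EReal) (V : ℝ → EuclideanSpace ℝ (Fin n)) (W : ℝ → Matrix (Fin n) (Fin n) ℝ) : Prop where
  initial_V : V 0 = v
  initial_W : W 0 = b
  deriv_V : ∀ t ∈ timeInterval T, ∀ i,
    HasDerivWithinAt (fun s => V s i) ((W t *ᵥ (V t).ofLp) i) (timeInterval T) t
  deriv_W : ∀ t ∈ timeInterval T, ∀ i j,
    HasDerivWithinAt (fun s => W s i j) (vecMulVec (V t).ofLp (V t).ofLp i j) (timeInterval T) t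

/-- `(V, W)` solves the system on `[0, T)`, and `[0, T)` is the maximal interval of existence: no
solution with the same initial values lives on a longer interval. -/
structure IsMaximalSolution {n : ℕ} (v : EuclideanSpace ℝ (Fin n))
    (b : Matrix (Fin n) (Fin n) ℝ) (T : EReal)
    (V : ℝ → EuclideanSpace ℝ (Fin n)) (W : ℝ → Matrix (Fin n) (Fin n) ℝ) : Prop where
  pos : 0 < T
  isSolution : IsSolution v b T V W
  maximal : ∀ (T' : EReal) (V' : ℝ → EuclideanSpace ℝ (Fin n))
    (W' : ℝ → Matrix (Fin n) (Fin n) ℝ), IsSolution v b T' V' W' → T' ≤ T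

/-- Strict structural balance in the limit: for all `i, j, k` the limit of `w_ij w_jk w_ki` as
`t → T` exists in `[-∞, +∞]` and is positive. -/
def StrictBalance {n : ℕ} (T : EReal) (W : ℝ → Matrix (Fin n) (Fin n) ℝ) : Prop :=
  ∀ i j k : Fin n, ∃ L : EReal, 0 < L ∧
    Tendsto (fun t => ((W t i j * W t j k * W t k i : ℝ) : EReal)) (timeTo T) (𝓝 L)

/-- The opinions die out: `T = +∞`, and `V(t)` and `V'(t)` tend to `0` as `t → ∞`. -/
def OpinionsVanish {n : ℕ} (T : EReal) (V : ℝ → EuclideanSpace ℝ (Fin n)) : Prop :=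
  T = ⊤ ∧ Tendsto (fun t => ‖V t‖) atTop (𝓝 0) ∧ Tendsto (deriv V) atTop (𝓝 0)

/-- The normalized opinion vector `V(t) / |V(t)|` converges as `t → T`. The limit is required to be
a unit vector, so that it does not come from the convention `0 / 0 = 0`. -/
def NormalizedOpinionConverges {n : ℕ} (T : EReal) (V : ℝ → EuclideanSpace ℝ (Fin n)) : Prop :=
  ∃ u : EuclideanSpace ℝ (Fin n), ‖u‖ = 1 ∧
    Tendsto (fun t => (‖V t‖)⁻¹ • V t) (timeTo T) (𝓝 u)

/-- A property holds for generic initial data if the exceptional set is both nowhere dense and of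
Lebesgue measure zero; so the property holds on a dense open set and almost everywhere. -/
def ForGenericData {n : ℕ} (P : InitialData n → Prop) : Prop :=
  IsNowhereDense {p | ¬ P p} ∧ volume {p | ¬ P p} = 0

end CoEvolution

/-!
The matrix `C = W² - V Vᵀ` is conserved, so `W` solves the matrix Riccati equation `W' = W² - C`
with `C = b² - v vᵀ` (`invariant`). It is linearized by `Y'' = C Y`, `Y(0) = 1`, `Y'(0) = -b`
(`fundY`): as long as the solution exists, `Y' = -W Y` and `Yᵀ V = v`, and a finite maximal time
`T` is the first singular time of `Y` (`IsMaximalSolution.det_fundY_eq_zero`).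

Finite time. Energy conservation `Y'ᵀ Y' - Yᵀ C Y = v vᵀ` makes the functional `x ↦ v · x`
injective on `ker Y(T)`, so this kernel is spanned by one vector `k`, scaled by `v · k = 1`. Then
`u = -Y'(T) k` is a unit vector spanning `ker Y(T)ᵀ`, and a rank-one modification of `Yᵀ` that
stays invertible at `T` gives `(T - t) V → u` and `(T - t) W → u uᵀ` (`IsSolution.tendsto_smul_V`,
`IsSolution.tendsto_smul_W`). Hence `V / |V| → u` always, and strict balance holds as soon as no
entry of `u` vanishes.

Infinite time. The quadratic forms of `W` are nondecreasing, and the Riccati equation bounds them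
on a global solution. So `W` converges, `V → 0` and `V' = W V → 0` (`IsSolution.opinionsVanish`).
If strict balance holds as well, the limit of `W` has a positive eigenvalue; its eigenvector turns
out to be an eigenvector of `b` orthogonal to `v`
(`IsSolution.exists_eigenvector_of_strictBalance`), which forces the Krylov determinant
`det [v, b v, …, b^(n-1) v]` to vanish.

Genericity. The zero set of the Krylov determinant is closed, and it is null because the
determinant is a nonzero polynomial along every line in a suitable direction. It remains to treat
the data whose blow-up direction `u` has a vanishing entry. Orthogonal matrices `O` act on the
data by `(v, b) ↦ (O v, O b Oᵀ)` and on the kernels of `Yᵀ` by `u ↦ O u`. For fixed data, `Y` has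
countably many singular times and almost every reflection moves all the corresponding directions
off the coordinate hyperplanes. As reflections preserve null sets, Fubini's theorem shows that the
degenerate data are null (`volume_degenerateData`). Finally `det Y` changes sign at each singular
time, so the set of data with a singular time before `N` is open; in it the degenerate data lie in
a closed null set, and so they are nowhere dense (`isNowhereDense_degenerateBlowUp`).
-/

namespace CoEvolution

section LinearFlow

open scoped Matrix.Norms.Operator

variable {n : ℕ}

/-! ### Calculus of matrix-valued functions -/

theorem _root_.HasDerivAt.linearMap_comp {E F : Type*} [NormedAddCommGroup E] [NormedSpace ℝ E]
    [FiniteDimensional ℝ E] [NormedAddCommGroup F] [NormedSpace ℝ F] (f : E →ₗ[ℝ] F) {A : ℝ → E}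
    {A' : E} {t : ℝ} (h : HasDerivAt A A' t) : HasDerivAt (fun s => f (A s)) (f A') t :=
  f.toContinuousLinearMap.hasFDerivAt.comp_hasDerivAt t h

theorem _root_.HasDerivWithinAt.linearMap_comp {E F : Type*} [NormedAddCommGroup E]
    [NormedSpace ℝ E] [FiniteDimensional ℝ E] [NormedAddCommGroup F] [NormedSpace ℝ F]
    (f : E →ₗ[ℝ] F) {A : ℝ → E} {A' : E} {t : ℝ} {s : Set ℝ} (h : HasDerivWithinAt A A' s t) :
    HasDerivWithinAt (fun s => f (A s)) (f A') s t :=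
  f.toContinuousLinearMap.hasFDerivAt.comp_hasDerivWithinAt t h

theorem hasDerivWithinAt_matrix {A : ℝ → Matrix (Fin n) (Fin n) ℝ} {A' : Matrix (Fin n) (Fin n) ℝ}
    {s : Set ℝ} {t : ℝ} :
    HasDerivWithinAt A A' s t ↔ ∀ i j, HasDerivWithinAt (fun r => A r i j) (A' i j) s t := by
  constructor
  · intro h i j
    exact h.linearMap_comp (entryLinearMap ℝ ℝ i j)
  · intro h
    have key : HasDerivWithinAt (fun r => ∑ i, ∑ j, A r i j • single i j (1 : ℝ))
        (∑ i, ∑ j, A' i j • single i j (1 : ℝ)) s t :=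
      HasDerivWithinAt.fun_sum fun i _ => HasDerivWithinAt.fun_sum fun j _ =>
        (h i j).smul_const _
    have e : ∀ B : Matrix (Fin n) (Fin n) ℝ, ∑ i, ∑ j, B i j • single i j (1 : ℝ) = B := by
      intro B
      conv_rhs => rw [matrix_eq_sum_single B]
      simp
    simpa only [e] using key

theorem _root_.HasDerivAt.matrix_transpose {A : ℝ → Matrix (Fin n) (Fin n) ℝ}
    {A' : Matrix (Fin n) (Fin n) ℝ} {t : ℝ} (h : HasDerivAt A A' t) :
    HasDerivAt (fun s => (A s)ᵀ) A'ᵀ t :=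
  h.linearMap_comp (transposeLinearEquiv (Fin n) (Fin n) ℝ ℝ).toLinearMap

/-! ### The linearization of the Riccati equation -/

/-- The matrix `b² - v vᵀ`. Along a solution `W² - V Vᵀ` keeps this value, so that `W` solves the
Riccati equation `W' = W² - invariant v b`. -/
def invariant (v : Fin n → ℝ) (b : Matrix (Fin n) (Fin n) ℝ) : Matrix (Fin n) (Fin n) ℝ :=
  b * b - vecMulVec v v

/-- The flow of the first-order form `(y, z)' = (z, C y)` of the linear equation `y'' = C y`. -/
noncomputable def linFlow (C : Matrix (Fin n) (Fin n) ℝ) (t : ℝ) :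
    Matrix (Fin n ⊕ Fin n) (Fin n ⊕ Fin n) ℝ :=
  NormedSpace.exp (t • fromBlocks 0 1 C 0)

/-- The matrix solution of `Y'' = C Y`, `Y(0) = 1`, `Y'(0) = -b`, where `C = invariant v b`. The
substitution `W = -Y' Y⁻¹` linearizes the Riccati equation. -/
noncomputable def fundY (v : Fin n → ℝ) (b : Matrix (Fin n) (Fin n) ℝ) (t : ℝ) :
    Matrix (Fin n) (Fin n) ℝ :=
  (linFlow (invariant v b) t).toBlocks₁₁ - (linFlow (invariant v b) t).toBlocks₁₂ * b

/-- The derivative of `fundY`. -/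
noncomputable def fundZ (v : Fin n → ℝ) (b : Matrix (Fin n) (Fin n) ℝ) (t : ℝ) :
    Matrix (Fin n) (Fin n) ℝ :=
  (linFlow (invariant v b) t).toBlocks₂₁ - (linFlow (invariant v b) t).toBlocks₂₂ * b

variable (v : Fin n → ℝ) (b : Matrix (Fin n) (Fin n) ℝ)

theorem invariant_isSymm (hb : b.IsSymm) : (invariant v b)ᵀ = invariant v b := by
  simp [invariant, hb.eq, transpose_vecMulVec]

theorem hasDerivAt_linFlow (C : Matrix (Fin n) (Fin n) ℝ) (t : ℝ) :
    HasDerivAt (linFlow C) (fromBlocks 0 1 C 0 * linFlow C t) t :=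
  hasDerivAt_exp_smul_const' (fromBlocks 0 1 C 0) t

theorem fundY_zero : fundY v b 0 = 1 := by
  simp only [fundY, linFlow, zero_smul, NormedSpace.exp_zero]
  rw [← fromBlocks_one, toBlocks_fromBlocks₁₁, toBlocks_fromBlocks₁₂, Matrix.zero_mul, sub_zero]

theorem fundZ_zero : fundZ v b 0 = -b := by
  simp only [fundZ, linFlow, zero_smul, NormedSpace.exp_zero]
  rw [← fromBlocks_one, toBlocks_fromBlocks₂₁, toBlocks_fromBlocks₂₂, Matrix.one_mul, zero_sub]

/-- The combinations of blocks of the flow that enter the fundamental solution satisfy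
`Y' = Z`, `Z' = C Y`. -/
theorem hasDerivAt_block (C : Matrix (Fin n) (Fin n) ℝ) (t : ℝ) :
    HasDerivAt (fun s => (linFlow C s).toBlocks₁₁ - (linFlow C s).toBlocks₁₂ * b)
      ((linFlow C t).toBlocks₂₁ - (linFlow C t).toBlocks₂₂ * b) t ∧
    HasDerivAt (fun s => (linFlow C s).toBlocks₂₁ - (linFlow C s).toBlocks₂₂ * b)
      (C * ((linFlow C t).toBlocks₁₁ - (linFlow C t).toBlocks₁₂ * b)) t := by
  let f₁ : Matrix (Fin n ⊕ Fin n) (Fin n ⊕ Fin n) ℝ →ₗ[ℝ] Matrix (Fin n) (Fin n) ℝ :=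
    { toFun := fun A => A.toBlocks₁₁ - A.toBlocks₁₂ * b
      map_add' := fun A B => by
        rw [show (A + B).toBlocks₁₁ = A.toBlocks₁₁ + B.toBlocks₁₁ from rfl,
          show (A + B).toBlocks₁₂ = A.toBlocks₁₂ + B.toBlocks₁₂ from rfl, Matrix.add_mul]
        abel
      map_smul' := fun c A => by
        rw [show (c • A).toBlocks₁₁ = c • A.toBlocks₁₁ from rfl,
          show (c • A).toBlocks₁₂ = c • A.toBlocks₁₂ from rfl, Matrix.smul_mul, smul_sub]
        rfl }
  let f₂ : Matrix (Fin n ⊕ Fin n) (Fin n ⊕ Fin n) ℝ →ₗ[ℝ] Matrix (Fin n) (Fin n) ℝ :=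
    { toFun := fun A => A.toBlocks₂₁ - A.toBlocks₂₂ * b
      map_add' := fun A B => by
        rw [show (A + B).toBlocks₂₁ = A.toBlocks₂₁ + B.toBlocks₂₁ from rfl,
          show (A + B).toBlocks₂₂ = A.toBlocks₂₂ + B.toBlocks₂₂ from rfl, Matrix.add_mul]
        abel
      map_smul' := fun c A => by
        rw [show (c • A).toBlocks₂₁ = c • A.toBlocks₂₁ from rfl,
          show (c • A).toBlocks₂₂ = c • A.toBlocks₂₂ from rfl, Matrix.smul_mul, smul_sub]
        rfl }
  have h := hasDerivAt_linFlow C t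
  have e : fromBlocks 0 1 C 0 * linFlow C t = fromBlocks (linFlow C t).toBlocks₂₁
      (linFlow C t).toBlocks₂₂ (C * (linFlow C t).toBlocks₁₁) (C * (linFlow C t).toBlocks₁₂) := by
    conv_lhs => rw [← fromBlocks_toBlocks (linFlow C t)]
    simp [fromBlocks_multiply]
  rw [e] at h
  refine ⟨?_, ?_⟩
  · exact (h.linearMap_comp f₁).congr_deriv (by simp [f₁])
  · exact (h.linearMap_comp f₂).congr_deriv (by simp [f₂, Matrix.mul_sub, Matrix.mul_assoc])

theorem hasDerivAt_fundY (t : ℝ) : HasDerivAt (fundY v b) (fundZ v b t) t :=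
  (hasDerivAt_block b _ t).1

theorem hasDerivAt_fundZ (t : ℝ) :
    HasDerivAt (fundZ v b) (invariant v b * fundY v b t) t :=
  (hasDerivAt_block b _ t).2

/-- The pair `(Y x, Y' x)` determines `x`, the flow being invertible. -/
theorem eq_zero_of_fund_mulVec {t : ℝ} {x : Fin n → ℝ} (hY : fundY v b t *ᵥ x = 0)
    (hZ : fundZ v b t *ᵥ x = 0) : x = 0 := by
  have hU : IsUnit (linFlow (invariant v b) t) := Matrix.isUnit_exp _
  have h0 : linFlow (invariant v b) t *ᵥ (Sum.elim x (-(b *ᵥ x))) = 0 := by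
    rw [← fromBlocks_toBlocks (linFlow (invariant v b) t), fromBlocks_mulVec]
    simp only [Sum.elim_comp_inl, Sum.elim_comp_inr, mulVec_neg, mulVec_mulVec]
    rw [← sub_eq_add_neg, ← sub_eq_add_neg, ← sub_mulVec, ← sub_mulVec]
    change Sum.elim (fundY v b t *ᵥ x) (fundZ v b t *ᵥ x) = 0
    rw [hY, hZ]
    ext i; cases i <;> rfl
  have h1 := (Matrix.mulVec_injective_of_isUnit hU) (h0.trans (mulVec_zero _).symm)
  ext i
  exact congrFun h1 (Sum.inl i)

/-- The Wronskian identity. -/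
theorem fundY_transpose_mul_fundZ (hb : b.IsSymm) (t : ℝ) :
    (fundY v b t)ᵀ * fundZ v b t = (fundZ v b t)ᵀ * fundY v b t := by
  have hd : ∀ s, HasDerivAt (fun r => (fundY v b r)ᵀ * fundZ v b r - (fundZ v b r)ᵀ * fundY v b r)
      0 s := by
    intro s
    have hY := hasDerivAt_fundY v b s
    have hZ := hasDerivAt_fundZ v b s
    refine ((hY.matrix_transpose.mul hZ).sub (hZ.matrix_transpose.mul hY)).congr_deriv ?_
    rw [transpose_mul, invariant_isSymm v b hb, Matrix.mul_assoc]
    abel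
  have := is_const_of_deriv_eq_zero (fun s => (hd s).differentiableAt) (fun s => (hd s).deriv) t 0
  simp only [fundY_zero, fundZ_zero, transpose_one, transpose_neg, hb.eq] at this
  rw [← sub_eq_zero, this]
  simp

/-- Energy conservation for `Y'' = C Y`. -/
theorem fund_energy (hb : b.IsSymm) (t : ℝ) :
    (fundZ v b t)ᵀ * fundZ v b t - (fundY v b t)ᵀ * (invariant v b * fundY v b t)
      = vecMulVec v v := by
  have hd : ∀ s, HasDerivAt (fun r => (fundZ v b r)ᵀ * fundZ v b r
      - (fundY v b r)ᵀ * (invariant v b * fundY v b r)) 0 s := by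
    intro s
    have hY := hasDerivAt_fundY v b s
    have hZ := hasDerivAt_fundZ v b s
    refine ((hZ.matrix_transpose.mul hZ).sub (hY.matrix_transpose.mul
      (hY.const_mul (invariant v b)))).congr_deriv ?_
    rw [transpose_mul, invariant_isSymm v b hb]
    simp only [Matrix.mul_assoc]
    abel
  have := is_const_of_deriv_eq_zero (fun s => (hd s).differentiableAt) (fun s => (hd s).deriv) t 0
  rw [this]
  simp [fundY_zero, fundZ_zero, hb.eq, invariant]

end LinearFlow

section Kernel

open scoped Matrix.Norms.Operator

variable {n : ℕ}

/-! ### Singular times of the fundamental solution -/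

/-- The data of a singular time `t` of `Y`: a vector `k` spanning `ker Y(t)`, scaled by `v · k = 1`,
and the unit vector `u = -Y'(t) k` spanning `ker Y(t)ᵀ`. The last field says in a coordinate-free
way that both kernels are one-dimensional. -/
structure KernelPair (v : Fin n → ℝ) (b : Matrix (Fin n) (Fin n) ℝ) (t : ℝ) (k u : Fin n → ℝ) :
    Prop where
  fundY_mulVec : fundY v b t *ᵥ k = 0
  fundZ_mulVec : fundZ v b t *ᵥ k = -u
  dot_eq_one : v ⬝ᵥ k = 1
  unit : u ⬝ᵥ u = 1
  transpose_mulVec : (fundY v b t)ᵀ *ᵥ u = 0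
  det_ne_zero : ((fundY v b t)ᵀ + vecMulVec k u).det ≠ 0

variable {v : Fin n → ℝ} {b : Matrix (Fin n) (Fin n) ℝ} {t₀ : ℝ} {k u : Fin n → ℝ}

theorem dotProduct_fundZ_of_mem_ker (hb : b.IsSymm) {x : Fin n → ℝ}
    (hx : fundY v b t₀ *ᵥ x = 0) :
    (fundZ v b t₀ *ᵥ x) ⬝ᵥ (fundZ v b t₀ *ᵥ x) = (v ⬝ᵥ x) * (v ⬝ᵥ x) := by
  have h := congrArg (fun A => x ⬝ᵥ (A *ᵥ x)) (fund_energy v b hb t₀)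
  simp only [sub_mulVec, ← mulVec_mulVec, hx, mulVec_zero, sub_zero, vecMulVec_mulVec] at h
  rw [dotProduct_mulVec, vecMul_transpose] at h
  rw [h]
  simp [dotProduct_smul, dotProduct_comm x v]

/-- On `ker Y(t₀)` the linear functional `x ↦ v · x` is injective. -/
theorem eq_zero_of_mem_ker (hb : b.IsSymm) {x : Fin n → ℝ}
    (hx : fundY v b t₀ *ᵥ x = 0) (hv : v ⬝ᵥ x = 0) : x = 0 := by
  have h := dotProduct_fundZ_of_mem_ker hb hx
  rw [hv, mul_zero, dotProduct_self_eq_zero] at h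
  exact eq_zero_of_fund_mulVec v b hx h

theorem exists_kernelPair (hb : b.IsSymm) (h : (fundY v b t₀).det = 0) :
    ∃ k u, KernelPair v b t₀ k u := by
  obtain ⟨x, hx0, hx⟩ := exists_mulVec_eq_zero_iff.mpr h
  have hvx : v ⬝ᵥ x ≠ 0 := fun hv => hx0 (eq_zero_of_mem_ker hb hx hv)
  set k := (v ⬝ᵥ x)⁻¹ • x with hk
  have hYk : fundY v b t₀ *ᵥ k = 0 := by rw [hk, mulVec_smul, hx, smul_zero]
  have hvk : v ⬝ᵥ k = 1 := by rw [hk, dotProduct_smul, smul_eq_mul, inv_mul_cancel₀ hvx]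
  set u := -(fundZ v b t₀ *ᵥ k) with hu
  have huu : u ⬝ᵥ u = 1 := by
    have := dotProduct_fundZ_of_mem_ker hb hYk
    rw [hvk] at this
    rw [hu, neg_dotProduct_neg, this, one_mul]
  have hYu : (fundY v b t₀)ᵀ *ᵥ u = 0 := by
    rw [hu, mulVec_neg, mulVec_mulVec, fundY_transpose_mul_fundZ v b hb, ← mulVec_mulVec, hYk,
      mulVec_zero, neg_zero]
  refine ⟨k, u, hYk, by rw [hu, neg_neg], hvk, huu, hYu, ?_⟩
  rw [← det_transpose, transpose_add, transpose_transpose, transpose_vecMulVec]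
  intro hdet
  obtain ⟨y, hy0, hy⟩ := exists_mulVec_eq_zero_iff.mpr hdet
  rw [add_mulVec, vecMulVec_mulVec] at hy
  have hky : k ⬝ᵥ y = 0 := by
    have := congrArg (fun z => u ⬝ᵥ z) hy
    simpa [dotProduct_add, dotProduct_mulVec, ← mulVec_transpose, hYu, huu] using this
  have hYy : fundY v b t₀ *ᵥ y = 0 := by simpa [hky] using hy
  have hyk : y - (v ⬝ᵥ y) • k = 0 := by
    apply eq_zero_of_mem_ker hb
    · rw [mulVec_sub, mulVec_smul, hYy, hYk, smul_zero, sub_zero]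
    · rw [dotProduct_sub, dotProduct_smul, hvk, smul_eq_mul, mul_one, sub_self]
  apply hy0
  have hyk' := sub_eq_zero.mp hyk
  rw [← dotProduct_self_eq_zero]
  nth_rw 1 [hyk']
  rw [smul_dotProduct, hky, smul_zero]

theorem KernelPair.eq_smul (h : KernelPair v b t₀ k u) {y : Fin n → ℝ}
    (hy : (fundY v b t₀)ᵀ *ᵥ y = 0) : y = (u ⬝ᵥ y) • u := by
  have : ((fundY v b t₀)ᵀ + vecMulVec k u) *ᵥ (y - (u ⬝ᵥ y) • u) = 0 := by
    rw [add_mulVec, vecMulVec_mulVec, mulVec_sub, mulVec_smul, hy, h.transpose_mulVec,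
      dotProduct_sub, dotProduct_smul, h.unit]
    simp
  exact sub_eq_zero.mp (eq_zero_of_mulVec_eq_zero h.det_ne_zero this)

/-- The matrix `Y(t)ᵀ + k (Y(t) k)ᵀ / (t₀ - t)`: it differs from `Y(t)ᵀ` by the invertible factor
`1 + k kᵀ / (t₀ - t)` and has an invertible limit as `t → t₀`. -/
noncomputable def regularized (v : Fin n → ℝ) (b : Matrix (Fin n) (Fin n) ℝ) (t₀ : ℝ)
    (k : Fin n → ℝ) (t : ℝ) : Matrix (Fin n) (Fin n) ℝ :=
  (fundY v b t)ᵀ + vecMulVec k ((t₀ - t)⁻¹ • (fundY v b t *ᵥ k))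

theorem continuous_fundY_right : Continuous (fundY v b) :=
  continuous_iff_continuousAt.mpr fun t => (hasDerivAt_fundY v b t).continuousAt

theorem continuous_fundZ_right : Continuous (fundZ v b) :=
  continuous_iff_continuousAt.mpr fun t => (hasDerivAt_fundZ v b t).continuousAt

theorem KernelPair.tendsto_slope (h : KernelPair v b t₀ k u) :
    Tendsto (fun t => (t₀ - t)⁻¹ • (fundY v b t *ᵥ k)) (𝓝[≠] t₀) (𝓝 u) := by
  have hd : HasDerivAt (fun t => fundY v b t *ᵥ k) (fundZ v b t₀ *ᵥ k) t₀ :=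
    (hasDerivAt_fundY v b t₀).linearMap_comp ((mulVecBilin ℝ ℝ).flip k)
  have hs := (hasDerivAt_iff_tendsto_slope.mp hd).neg
  rw [h.fundZ_mulVec, neg_neg] at hs
  refine hs.congr fun t => ?_
  rw [slope_def_module, h.fundY_mulVec, sub_zero, ← neg_smul, ← inv_neg, neg_sub]

theorem KernelPair.tendsto_regularized (h : KernelPair v b t₀ k u) :
    Tendsto (regularized v b t₀ k) (𝓝[≠] t₀) (𝓝 ((fundY v b t₀)ᵀ + vecMulVec k u)) := by
  refine Tendsto.add ?_ ?_
  · exact (continuous_fundY_right.matrix_transpose.tendsto t₀).mono_left nhdsWithin_le_nhds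
  · exact ((continuous_const.matrix_vecMulVec continuous_id).tendsto u).comp h.tendsto_slope

theorem sub_mul_det_regularized {t : ℝ} (ht : t ≠ t₀) :
    (t₀ - t) * (regularized v b t₀ k t).det = (t₀ - t + k ⬝ᵥ k) * (fundY v b t).det := by
  have h0 : t₀ - t ≠ 0 := sub_ne_zero.mpr ht.symm
  have e : regularized v b t₀ k t = (1 + vecMulVec ((t₀ - t)⁻¹ • k) k) * (fundY v b t)ᵀ := by
    rw [regularized, Matrix.add_mul, Matrix.one_mul, vecMulVec_mul, vecMul_transpose]
    simp
  rw [e, det_mul, det_transpose, vecMulVec_eq Unit, det_one_add_replicateCol_mul_replicateRow,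
    dotProduct_smul, smul_eq_mul]
  field_simp

/-- Next to a singular time `det Y` is nonzero, with opposite signs on the two sides. -/
theorem exists_sign_change (hb : b.IsSymm) (h : (fundY v b t₀).det = 0) :
    ∃ δ : ℝ, δ ≠ 0 ∧ ∀ᶠ t in 𝓝[≠] t₀, 0 < (t₀ - t) * δ * (fundY v b t).det := by
  obtain ⟨k, u, hku⟩ := exists_kernelPair hb h
  refine ⟨((fundY v b t₀)ᵀ + vecMulVec k u).det, hku.det_ne_zero, ?_⟩
  have hk : 0 < k ⬝ᵥ k := by
    refine lt_of_le_of_ne (by simpa using dotProduct_star_self_nonneg k) fun h0 => ?_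
    have := dotProduct_self_eq_zero.mp h0.symm
    simpa [this] using hku.dot_eq_one
  set D := ((fundY v b t₀)ᵀ + vecMulVec k u).det with hD
  have h1 : Tendsto (fun t => (regularized v b t₀ k t).det) (𝓝[≠] t₀) (𝓝 D) :=
    ((continuous_id.matrix_det).tendsto _).comp hku.tendsto_regularized
  have h2 : ∀ᶠ t in 𝓝[≠] t₀, 0 < D * (regularized v b t₀ k t).det := by
    refine (h1.const_mul D).eventually_const_lt ?_
    exact mul_self_pos.mpr hku.det_ne_zero
  have h3 : ∀ᶠ t in 𝓝[≠] t₀, 0 < t₀ - t + k ⬝ᵥ k := by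
    have : Tendsto (fun t => t₀ - t + k ⬝ᵥ k) (𝓝 t₀) (𝓝 (t₀ - t₀ + k ⬝ᵥ k)) := by
      apply Continuous.tendsto; fun_prop
    exact (this.mono_left nhdsWithin_le_nhds).eventually_const_lt (by simpa using hk)
  filter_upwards [h2, h3, self_mem_nhdsWithin] with t ht2 ht3 ht
  have h0 : t₀ - t ≠ 0 := sub_ne_zero.mpr (Ne.symm ht)
  have e := sub_mul_det_regularized (v := v) (b := b) (k := k) ht
  have : (t₀ - t + k ⬝ᵥ k) * ((t₀ - t) * D * (fundY v b t).det)
      = (t₀ - t) ^ 2 * (D * (regularized v b t₀ k t).det) := by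
    linear_combination -(t₀ - t) * D * e
  refine (mul_pos_iff_of_pos_left ht3).mp ?_
  rw [this]
  positivity

end Kernel

section Riccati

open scoped Matrix.Norms.Operator

variable {n : ℕ}

/-! ### Time intervals -/

theorem isOpen_lt_time (T : EReal) : IsOpen {t : ℝ | (t : EReal) < T} :=
  isOpen_Iio.preimage continuous_coe_real_ereal

theorem Icc_subset_timeInterval {T : EReal} {t : ℝ} (ht : t ∈ timeInterval T) :
    Set.Icc 0 t ⊆ timeInterval T := fun _ hs =>
  ⟨hs.1, (EReal.coe_le_coe_iff.mpr hs.2).trans_lt ht.2⟩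

theorem timeInterval_mem_nhdsGE {T : EReal} {t : ℝ} (ht : t ∈ timeInterval T) :
    timeInterval T ∈ 𝓝[≥] t := by
  filter_upwards [self_mem_nhdsWithin, mem_nhdsWithin_of_mem_nhds
    ((isOpen_lt_time T).mem_nhds ht.2)] with s hs hs'
  exact ⟨ht.1.trans hs, hs'⟩

theorem timeInterval_mem_nhds {T : EReal} {t : ℝ} (ht : t ∈ timeInterval T) (h0 : 0 < t) :
    timeInterval T ∈ 𝓝 t := by
  filter_upwards [lt_mem_nhds h0, (isOpen_lt_time T).mem_nhds ht.2] with s hs hs'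
  exact ⟨hs.le, hs'⟩

section

variable {E : Type*} [NormedAddCommGroup E] [NormedSpace ℝ E] {T : EReal} {f f' : ℝ → E}

theorem continuousOn_Icc_of_hasDerivWithinAt
    (hf : ∀ t ∈ timeInterval T, HasDerivWithinAt f (f' t) (timeInterval T) t) {t : ℝ}
    (ht : t ∈ timeInterval T) : ContinuousOn f (Set.Icc 0 t) := fun s hs =>
  ((hf s (Icc_subset_timeInterval ht hs)).continuousWithinAt).mono (Icc_subset_timeInterval ht)

theorem hasDerivWithinAt_Ici
    (hf : ∀ t ∈ timeInterval T, HasDerivWithinAt f (f' t) (timeInterval T) t) {t : ℝ}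
    (ht : t ∈ timeInterval T) : HasDerivWithinAt f (f' t) (Set.Ici t) t :=
  (hf t ht).mono_of_mem_nhdsWithin (timeInterval_mem_nhdsGE ht)

theorem eq_initial_of_hasDerivWithinAt_zero
    (hf : ∀ t ∈ timeInterval T, HasDerivWithinAt f 0 (timeInterval T) t) {t : ℝ}
    (ht : t ∈ timeInterval T) : f t = f 0 :=
  constant_of_has_deriv_right_zero (continuousOn_Icc_of_hasDerivWithinAt (f' := fun _ => 0) hf ht)
    (fun _ hs => hasDerivWithinAt_Ici (f' := fun _ => 0) hf
      (Icc_subset_timeInterval ht (Set.Ico_subset_Icc_self hs))) t ⟨ht.1, le_rfl⟩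

end

theorem _root_.HasDerivWithinAt.matrix_mulVec {A : ℝ → Matrix (Fin n) (Fin n) ℝ}
    {A' : Matrix (Fin n) (Fin n) ℝ} {x : ℝ → Fin n → ℝ} {x' : Fin n → ℝ} {s : Set ℝ} {t : ℝ}
    (hA : HasDerivWithinAt A A' s t) (hx : HasDerivWithinAt x x' s t) :
    HasDerivWithinAt (fun r => A r *ᵥ x r) (A t *ᵥ x' + A' *ᵥ x t) s t := by
  rw [hasDerivWithinAt_pi] at hx ⊢
  rw [hasDerivWithinAt_matrix] at hA
  intro i
  refine (HasDerivWithinAt.fun_sum fun j (_ : j ∈ Finset.univ) =>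
    (hA i j).mul (hx j)).congr_deriv ?_
  simp only [Pi.add_apply, mulVec, dotProduct, ← Finset.sum_add_distrib]
  exact Finset.sum_congr rfl fun j _ => add_comm _ _

theorem _root_.HasDerivWithinAt.vecMulVec_self {x : ℝ → Fin n → ℝ} {x' : Fin n → ℝ} {s : Set ℝ}
    {t : ℝ} (hx : HasDerivWithinAt x x' s t) :
    HasDerivWithinAt (fun r => vecMulVec (x r) (x r)) (vecMulVec x' (x t) + vecMulVec (x t) x')
      s t := by
  rw [hasDerivWithinAt_pi] at hx
  rw [hasDerivWithinAt_matrix]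
  intro i j
  exact (hx i).mul (hx j)

/-! ### Solutions and the fundamental solution -/

variable {v : EuclideanSpace ℝ (Fin n)} {b : Matrix (Fin n) (Fin n) ℝ} {T : EReal}
  {V : ℝ → EuclideanSpace ℝ (Fin n)} {W : ℝ → Matrix (Fin n) (Fin n) ℝ}

namespace IsSolution

theorem hasDeriv_V (h : IsSolution v b T V W) {t : ℝ} (ht : t ∈ timeInterval T) :
    HasDerivWithinAt (fun s => (V s).ofLp) (W t *ᵥ (V t).ofLp) (timeInterval T) t :=
  hasDerivWithinAt_pi.mpr (h.deriv_V t ht)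

theorem hasDeriv_W (h : IsSolution v b T V W) {t : ℝ} (ht : t ∈ timeInterval T) :
    HasDerivWithinAt W (vecMulVec (V t).ofLp (V t).ofLp) (timeInterval T) t :=
  hasDerivWithinAt_matrix.mpr (h.deriv_W t ht)

theorem isSymm (h : IsSolution v b T V W) (hb : b.IsSymm) {t : ℝ} (ht : t ∈ timeInterval T) :
    (W t).IsSymm := by
  have key : ∀ s ∈ timeInterval T,
      HasDerivWithinAt (fun s => (W s)ᵀ - W s) 0 (timeInterval T) s := by
    intro s hs
    have := h.hasDeriv_W hs
    refine ((this.linearMap_comp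
      (transposeLinearEquiv (Fin n) (Fin n) ℝ ℝ).toLinearMap).sub this).congr_deriv ?_
    simp [transpose_vecMulVec]
  have := eq_initial_of_hasDerivWithinAt_zero key ht
  rw [h.initial_W, hb.eq, sub_self] at this
  exact sub_eq_zero.mp this

/-- The conserved matrix of the system. -/
theorem sq_sub_vecMulVec (h : IsSolution v b T V W) (hb : b.IsSymm) {t : ℝ}
    (ht : t ∈ timeInterval T) :
    W t * W t - vecMulVec (V t).ofLp (V t).ofLp = invariant v.ofLp b := by
  have key : ∀ s ∈ timeInterval T, HasDerivWithinAt
      (fun s => W s * W s - vecMulVec (V s).ofLp (V s).ofLp) 0 (timeInterval T) s := by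
    intro s hs
    have hW := h.hasDeriv_W hs
    refine ((hW.mul hW).sub (h.hasDeriv_V hs).vecMulVec_self).congr_deriv ?_
    rw [vecMulVec_mul, mul_vecMulVec, ← mulVec_transpose, (h.isSymm hb hs).eq]
    abel
  have := eq_initial_of_hasDerivWithinAt_zero key ht
  rw [this, h.initial_W, h.initial_V, invariant]

/-- `Y' = -W Y` as long as the solution exists. -/
theorem fundZ_eq (h : IsSolution v b T V W) (hb : b.IsSymm) {t : ℝ} (ht : t ∈ timeInterval T) :
    fundZ v.ofLp b t = -(W t * fundY v.ofLp b t) := by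
  set g : ℝ → Matrix (Fin n) (Fin n) ℝ := fun s => fundZ v.ofLp b s + W s * fundY v.ofLp b s
    with hg
  have hd : ∀ s ∈ timeInterval T, HasDerivWithinAt g (W s * g s) (timeInterval T) s := by
    intro s hs
    have hW := h.hasDeriv_W hs
    have hY := (hasDerivAt_fundY v.ofLp b s).hasDerivWithinAt (s := timeInterval T)
    have hZ := (hasDerivAt_fundZ v.ofLp b s).hasDerivWithinAt (s := timeInterval T)
    refine (hZ.add (hW.mul hY)).congr_deriv ?_
    rw [← h.sq_sub_vecMulVec hb hs, hg]
    simp only [Matrix.mul_add, Matrix.sub_mul, Matrix.mul_assoc]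
    abel
  have hWc : ContinuousOn (fun s => ‖W s‖) (Set.Icc 0 t) :=
    (continuousOn_Icc_of_hasDerivWithinAt (fun s hs => h.hasDeriv_W hs) ht).norm
  obtain ⟨K, hK⟩ := isCompact_Icc.bddAbove_image hWc
  have hz := eq_zero_of_abs_deriv_le_mul_abs_self_of_eq_zero_right (f := g)
    (f' := fun s => W s * g s) (K := K) (a := 0) (b := t)
    (continuousOn_Icc_of_hasDerivWithinAt hd ht)
    (fun s hs => hasDerivWithinAt_Ici hd
      (Icc_subset_timeInterval ht (Set.Ico_subset_Icc_self hs)))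
    (by simp [hg, fundZ_zero, fundY_zero, h.initial_W])
    (fun s hs => (norm_mul_le _ _).trans (mul_le_mul_of_nonneg_right
      (hK ⟨s, Set.Ico_subset_Icc_self hs, rfl⟩) (norm_nonneg _))) t ⟨ht.1, le_rfl⟩
  exact eq_neg_of_add_eq_zero_left hz

theorem fundY_transpose_mulVec (h : IsSolution v b T V W) (hb : b.IsSymm) {t : ℝ}
    (ht : t ∈ timeInterval T) : (fundY v.ofLp b t)ᵀ *ᵥ (V t).ofLp = v.ofLp := by
  have key : ∀ s ∈ timeInterval T, HasDerivWithinAt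
      (fun s => (fundY v.ofLp b s)ᵀ *ᵥ (V s).ofLp) 0 (timeInterval T) s := by
    intro s hs
    refine ((hasDerivAt_fundY v.ofLp b s).matrix_transpose.hasDerivWithinAt.matrix_mulVec
      (h.hasDeriv_V hs)).congr_deriv ?_
    rw [h.fundZ_eq hb hs, transpose_neg, transpose_mul, (h.isSymm hb hs).eq, neg_mulVec,
      mulVec_mulVec, add_neg_cancel]
  have := eq_initial_of_hasDerivWithinAt_zero key ht
  rw [this, fundY_zero, transpose_one, one_mulVec, h.initial_V]

theorem det_fundY_ne_zero (h : IsSolution v b T V W) (hb : b.IsSymm) {t : ℝ}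
    (ht : t ∈ timeInterval T) : (fundY v.ofLp b t).det ≠ 0 := by
  intro h0
  obtain ⟨x, hx0, hx⟩ := exists_mulVec_eq_zero_iff.mpr h0
  refine hx0 (eq_zero_of_fund_mulVec v.ofLp b hx ?_)
  rw [h.fundZ_eq hb ht, neg_mulVec, ← mulVec_mulVec, hx, mulVec_zero, neg_zero]

end IsSolution

theorem _root_.HasDerivAt.matrix_inv {A : ℝ → Matrix (Fin n) (Fin n) ℝ}
    {A' : Matrix (Fin n) (Fin n) ℝ} {t : ℝ} (h : HasDerivAt A A' t) (hA : (A t).det ≠ 0) :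
    HasDerivAt (fun s => (A s)⁻¹) (-((A t)⁻¹ * A' * (A t)⁻¹)) t := by
  have hU : IsUnit (A t) := (Matrix.isUnit_iff_isUnit_det _).mpr hA.isUnit
  obtain ⟨U, hU⟩ := hU
  have h1 := hasFDerivAt_ringInverse (𝕜 := ℝ) U
  rw [hU] at h1
  have h2 := h1.comp_hasDerivAt t h
  have e : (fun s => (A s)⁻¹) = Ring.inverse ∘ A := by
    ext1 s; exact nonsing_inv_eq_ringInverse _
  rw [e]
  refine h2.congr_deriv ?_
  have : (↑U⁻¹ : Matrix (Fin n) (Fin n) ℝ) = (A t)⁻¹ := by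
    rw [← hU, coe_units_inv]
  simp [this]

/-- The fundamental solution produces a solution of the system up to its first singular time. -/
theorem isSolution_of_det_ne_zero (hb : b.IsSymm)
    (hdet : ∀ t ∈ timeInterval T, (fundY v.ofLp b t).det ≠ 0) :
    IsSolution v b T (fun t => WithLp.toLp 2 (((fundY v.ofLp b t)⁻¹)ᵀ *ᵥ v.ofLp))
      (fun t => -(fundZ v.ofLp b t * (fundY v.ofLp b t)⁻¹)) := by
  have hinv : ∀ t ∈ timeInterval T, fundY v.ofLp b t * (fundY v.ofLp b t)⁻¹ = 1 := fun t ht =>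
    mul_nonsing_inv _ (hdet t ht).isUnit
  -- `Yᵀ W Y = -Yᵀ Y'` is symmetric by the Wronskian identity.
  have hsymm : ∀ t ∈ timeInterval T, (-(fundZ v.ofLp b t * (fundY v.ofLp b t)⁻¹))ᵀ
      = -(fundZ v.ofLp b t * (fundY v.ofLp b t)⁻¹) := by
    intro t ht
    have hw := fundY_transpose_mul_fundZ v.ofLp b hb t
    have hi := hinv t ht
    have hi' := congrArg transpose hi
    set Y := fundY v.ofLp b t
    set Z := fundZ v.ofLp b t
    rw [transpose_mul, transpose_one] at hi'
    rw [transpose_neg, transpose_mul]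
    congr 1
    calc (Y⁻¹)ᵀ * Zᵀ = (Y⁻¹)ᵀ * (Zᵀ * Y) * Y⁻¹ := by
          rw [Matrix.mul_assoc, Matrix.mul_assoc, hi, Matrix.mul_one]
      _ = Z * Y⁻¹ := by
          rw [← hw, ← Matrix.mul_assoc, hi', Matrix.one_mul]
  refine ⟨?_, ?_, ?_, ?_⟩
  · simp [fundY_zero]
  · simp [fundY_zero, fundZ_zero]
  · intro t ht
    have hs := hsymm t ht
    have hY := (hasDerivAt_fundY v.ofLp b t).matrix_inv (hdet t ht)
    have := (hY.matrix_transpose.hasDerivWithinAt (s := timeInterval T)).matrix_mulVec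
      (hasDerivWithinAt_const t _ v.ofLp)
    refine hasDerivWithinAt_pi.mp (this.congr_deriv ?_)
    simp only [mulVec_zero, zero_add, mulVec_mulVec]
    congr 1
    nth_rw 1 [← hs]
    rw [← transpose_mul, Matrix.mul_neg, Matrix.mul_assoc]
  · intro t ht
    have hs := hsymm t ht
    have hi := hinv t ht
    have hY := (hasDerivAt_fundY v.ofLp b t).matrix_inv (hdet t ht)
    have := (((hasDerivAt_fundZ v.ofLp b t).mul hY).neg).hasDerivWithinAt (s := timeInterval T)
    refine hasDerivWithinAt_matrix.mp (this.congr_deriv ?_)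
    have he := fund_energy v.ofLp b hb t
    set Y := fundY v.ofLp b t
    set Z := fundZ v.ofLp b t
    set C := invariant v.ofLp b
    have hi' := congrArg transpose hi
    rw [transpose_mul, transpose_one] at hi'
    have hs' : (Y⁻¹)ᵀ * Zᵀ = Z * Y⁻¹ := by simpa using hs
    have e1 : vecMulVec ((Y⁻¹)ᵀ *ᵥ v.ofLp) ((Y⁻¹)ᵀ *ᵥ v.ofLp)
        = (Y⁻¹)ᵀ * vecMulVec v.ofLp v.ofLp * Y⁻¹ := by
      rw [mul_vecMulVec, vecMulVec_mul, ← mulVec_transpose]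
    change _ = vecMulVec ((Y⁻¹)ᵀ *ᵥ v.ofLp) ((Y⁻¹)ᵀ *ᵥ v.ofLp)
    rw [e1, ← he]
    calc -(C * Y * Y⁻¹ + Z * -(Y⁻¹ * Z * Y⁻¹))
        = (Z * Y⁻¹) * (Z * Y⁻¹) - C := by
          rw [Matrix.mul_assoc C, hi, Matrix.mul_one]
          simp only [Matrix.mul_neg, Matrix.mul_assoc]
          abel
      _ = (Y⁻¹)ᵀ * Zᵀ * (Z * Y⁻¹) - ((Y⁻¹)ᵀ * Yᵀ) * C * (Y * Y⁻¹) := by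
          rw [hs', hi', hi, Matrix.one_mul, Matrix.mul_one]
      _ = _ := by simp only [Matrix.mul_sub, Matrix.sub_mul, Matrix.mul_assoc]

/-- A finite maximal time is a singular time of `Y`. -/
theorem IsMaximalSolution.det_fundY_eq_zero (hb : b.IsSymm) {τ : ℝ}
    (h : IsMaximalSolution v b τ V W) : (fundY v.ofLp b τ).det = 0 := by
  by_contra hne
  have hc : Continuous fun t => (fundY v.ofLp b t).det := continuous_fundY_right.matrix_det
  obtain ⟨ε, hε, hball⟩ := Metric.eventually_nhds_iff_ball.mp (hc.continuousAt.eventually_ne hne)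
  have hsol : IsSolution v b ((τ + ε : ℝ) : EReal) _ _ := isSolution_of_det_ne_zero hb (by
    intro t ht
    by_cases htτ : t < τ
    · exact h.isSolution.det_fundY_ne_zero hb ⟨ht.1, EReal.coe_lt_coe_iff.mpr htτ⟩
    · refine hball t ?_
      have := EReal.coe_lt_coe_iff.mp ht.2
      rw [Metric.mem_ball, Real.dist_eq, abs_of_nonneg (by linarith)]
      linarith)
  have := EReal.coe_le_coe_iff.mp (h.maximal _ _ _ hsol)
  linarith

end Riccati

section FiniteTime

open scoped Matrix.Norms.Operator

variable {n : ℕ}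

/-! ### Blow-up in finite time -/

theorem timeTo_coe (τ : ℝ) : timeTo (τ : EReal) = 𝓝[<] τ := by
  rw [timeTo, nhdsWithin, comap_inf, comap_principal, ← EReal.isOpenEmbedding_coe.nhds_eq_comap]
  congr 2
  ext t
  simp

theorem timeTo_top : timeTo ⊤ = atTop := by
  have : Set.Iio (⊤ : EReal) = {⊤}ᶜ := by ext; simp [lt_top_iff_ne_top]
  rw [timeTo, this, EReal.nhdsWithin_top, comap_map EReal.coe_injective]

theorem tendsto_matrix_inv {α : Type*} {l : Filter α} {A : α → Matrix (Fin n) (Fin n) ℝ}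
    {B : Matrix (Fin n) (Fin n) ℝ} (h : Tendsto A l (𝓝 B)) (hB : B.det ≠ 0) :
    Tendsto (fun s => (A s)⁻¹) l (𝓝 B⁻¹) := by
  obtain ⟨U, rfl⟩ := (Matrix.isUnit_iff_isUnit_det B).mpr hB.isUnit
  simp only [nonsing_inv_eq_ringInverse]
  exact (NormedRing.inverse_continuousAt U).tendsto.comp h

variable {v : EuclideanSpace ℝ (Fin n)} {b : Matrix (Fin n) (Fin n) ℝ} {τ : ℝ}
  {V : ℝ → EuclideanSpace ℝ (Fin n)} {W : ℝ → Matrix (Fin n) (Fin n) ℝ} {k u : Fin n → ℝ}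

theorem eventually_mem_timeInterval (hτ : 0 < τ) :
    ∀ᶠ t in 𝓝[<] τ, t < τ ∧ t ∈ timeInterval (τ : EReal) := by
  filter_upwards [self_mem_nhdsWithin, mem_nhdsWithin_of_mem_nhds (lt_mem_nhds hτ)] with t ht h0
  exact ⟨ht, h0.le, EReal.coe_lt_coe_iff.mpr ht⟩

theorem KernelPair.regularized_limit_mulVec (hku : KernelPair v.ofLp b τ k u) :
    ((fundY v.ofLp b τ)ᵀ + vecMulVec k u) *ᵥ u = k := by
  rw [add_mulVec, hku.transpose_mulVec, vecMulVec_mulVec, hku.unit]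
  simp

theorem KernelPair.tendsto_regularized_inv (hku : KernelPair v.ofLp b τ k u) :
    Tendsto (fun t => (regularized v.ofLp b τ k t)⁻¹) (𝓝[<] τ)
      (𝓝 ((fundY v.ofLp b τ)ᵀ + vecMulVec k u)⁻¹) :=
  tendsto_matrix_inv (hku.tendsto_regularized.mono_left
    (nhdsWithin_mono _ fun _ h => ne_of_lt h)) hku.det_ne_zero

theorem KernelPair.eventually_det_regularized (hku : KernelPair v.ofLp b τ k u) :
    ∀ᶠ t in 𝓝[<] τ, (regularized v.ofLp b τ k t).det ≠ 0 :=
  (((continuous_id.matrix_det).tendsto _).comp (hku.tendsto_regularized.mono_left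
    (nhdsWithin_mono _ fun _ h => ne_of_lt h))).eventually_ne hku.det_ne_zero

theorem tendsto_sub_left (τ : ℝ) : Tendsto (fun t => τ - t) (𝓝[<] τ) (𝓝 0) := by
  have : Tendsto (fun t => τ - t) (𝓝 τ) (𝓝 (τ - τ)) := (by fun_prop : Continuous _).tendsto τ
  rw [sub_self] at this
  exact this.mono_left nhdsWithin_le_nhds

/-- At a finite blow-up time `V ~ u / (τ - t)`: the vector `(τ - t) V` solves a linear system with
the matrix `regularized`. -/
theorem IsSolution.tendsto_smul_V (h : IsSolution v b τ V W) (hτ : 0 < τ) (hb : b.IsSymm)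
    (hku : KernelPair v.ofLp b τ k u) :
    Tendsto (fun t => (τ - t) • (V t).ofLp) (𝓝[<] τ) (𝓝 u) := by
  have hr : Tendsto (fun t => (τ - t) • v.ofLp + k) (𝓝[<] τ) (𝓝 k) := by
    simpa using ((tendsto_sub_left τ).smul_const v.ofLp).add_const k
  have hlim : Tendsto (fun t => (regularized v.ofLp b τ k t)⁻¹ *ᵥ ((τ - t) • v.ofLp + k))
      (𝓝[<] τ) (𝓝 (((fundY v.ofLp b τ)ᵀ + vecMulVec k u)⁻¹ *ᵥ k)) :=
    ((continuous_fst.matrix_mulVec continuous_snd).tendsto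
      (((fundY v.ofLp b τ)ᵀ + vecMulVec k u)⁻¹, k)).comp
      (hku.tendsto_regularized_inv.prodMk_nhds hr)
  have hu : ((fundY v.ofLp b τ)ᵀ + vecMulVec k u)⁻¹ *ᵥ k = u := by
    nth_rw 2 [← hku.regularized_limit_mulVec]
    rw [mulVec_mulVec, nonsing_inv_mul _ hku.det_ne_zero.isUnit, one_mulVec]
  rw [hu] at hlim
  refine hlim.congr' ?_
  filter_upwards [hku.eventually_det_regularized, eventually_mem_timeInterval hτ] with t hdet ht
  have h0 : τ - t ≠ 0 := (sub_pos.mpr ht.1).ne'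
  have hE : regularized v.ofLp b τ k t *ᵥ ((τ - t) • (V t).ofLp) = (τ - t) • v.ofLp + k := by
    have h1 : (fundY v.ofLp b t *ᵥ k) ⬝ᵥ (V t).ofLp = 1 := by
      rw [dotProduct_comm, dotProduct_mulVec, ← mulVec_transpose,
        h.fundY_transpose_mulVec hb ht.2, hku.dot_eq_one]
    rw [regularized, add_mulVec, mulVec_smul, h.fundY_transpose_mulVec hb ht.2, vecMulVec_mulVec,
      dotProduct_smul, smul_dotProduct, h1]
    simp [h0]
  rw [← hE, mulVec_mulVec, nonsing_inv_mul _ hdet.isUnit, one_mulVec]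

/-- At a finite blow-up time `W ~ u uᵀ / (τ - t)`. -/
theorem IsSolution.tendsto_smul_W (h : IsSolution v b τ V W) (hτ : 0 < τ) (hb : b.IsSymm)
    (hku : KernelPair v.ofLp b τ k u) :
    Tendsto (fun t => (τ - t) • W t) (𝓝[<] τ) (𝓝 (vecMulVec u u)) := by
  have hZ : Tendsto (fundZ v.ofLp b) (𝓝[<] τ) (𝓝 (fundZ v.ofLp b τ)) :=
    (continuous_fundZ_right.tendsto τ).mono_left nhdsWithin_le_nhds
  have hZk : Tendsto (fun t => vecMulVec k (fundZ v.ofLp b t *ᵥ k)) (𝓝[<] τ)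
      (𝓝 (vecMulVec k (fundZ v.ofLp b τ *ᵥ k))) :=
    ((continuous_const.matrix_vecMulVec
      (continuous_id.matrix_mulVec continuous_const)).tendsto (fundZ v.ofLp b τ)).comp hZ
  have hZt : Tendsto (fun t => (fundZ v.ofLp b t)ᵀ) (𝓝[<] τ) (𝓝 (fundZ v.ofLp b τ)ᵀ) :=
    ((continuous_id.matrix_transpose).tendsto _).comp hZ
  have hr : Tendsto (fun t => -((τ - t) • (fundZ v.ofLp b t)ᵀ
      + vecMulVec k (fundZ v.ofLp b t *ᵥ k))) (𝓝[<] τ) (𝓝 (vecMulVec k u)) := by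
    have := (((tendsto_sub_left τ).smul hZt).add hZk).neg
    rw [hku.fundZ_mulVec, vecMulVec_neg, zero_smul, zero_add, neg_neg] at this
    exact this
  have hlim := hku.tendsto_regularized_inv.mul hr
  have hu : ((fundY v.ofLp b τ)ᵀ + vecMulVec k u)⁻¹ * vecMulVec k u = vecMulVec u u := by
    have : vecMulVec k u = ((fundY v.ofLp b τ)ᵀ + vecMulVec k u) * vecMulVec u u := by
      rw [mul_vecMulVec, hku.regularized_limit_mulVec]
    nth_rw 2 [this]
    rw [← Matrix.mul_assoc, nonsing_inv_mul _ hku.det_ne_zero.isUnit, Matrix.one_mul]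
  rw [hu] at hlim
  refine hlim.congr' ?_
  filter_upwards [hku.eventually_det_regularized, eventually_mem_timeInterval hτ] with t hdet ht
  have h0 : τ - t ≠ 0 := (sub_pos.mpr ht.1).ne'
  have hWs := h.isSymm hb ht.2
  have hF : regularized v.ofLp b τ k t * ((τ - t) • W t) = -((τ - t) • (fundZ v.ofLp b t)ᵀ
      + vecMulVec k (fundZ v.ofLp b t *ᵥ k)) := by
    have h1 : (fundY v.ofLp b t)ᵀ * W t = -(fundZ v.ofLp b t)ᵀ := by
      rw [h.fundZ_eq hb ht.2, transpose_neg, transpose_mul, hWs.eq, neg_neg]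
    have h2 : (fundY v.ofLp b t *ᵥ k) ᵥ* W t = -(fundZ v.ofLp b t *ᵥ k) := by
      rw [h.fundZ_eq hb ht.2, ← mulVec_transpose, hWs.eq, neg_mulVec, neg_neg, mulVec_mulVec]
    rw [regularized, Matrix.add_mul, Matrix.mul_smul, Matrix.mul_smul, h1, vecMulVec_mul,
      smul_vecMul, h2, vecMulVec_smul, smul_smul, mul_inv_cancel₀ h0, one_smul, vecMulVec_neg,
      smul_neg, neg_add]
  rw [← hF, ← Matrix.mul_assoc, nonsing_inv_mul _ hdet.isUnit, Matrix.one_mul]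

theorem IsSolution.normalizedOpinionConverges (h : IsSolution v b τ V W) (hτ : 0 < τ)
    (hb : b.IsSymm) (hku : KernelPair v.ofLp b τ k u) : NormalizedOpinionConverges τ V := by
  have hu : ‖WithLp.toLp 2 u‖ = 1 := by
    rw [← sq_eq_sq₀ (norm_nonneg _) zero_le_one, EuclideanSpace.real_norm_sq_eq, one_pow,
      ← hku.unit]
    simp [dotProduct, sq]
  refine ⟨WithLp.toLp 2 u, hu, ?_⟩
  rw [timeTo_coe]
  have hE : Tendsto (fun t => (τ - t) • V t) (𝓝[<] τ) (𝓝 (WithLp.toLp 2 u)) :=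
    ((PiLp.continuous_toLp 2 _).tendsto u).comp (h.tendsto_smul_V hτ hb hku)
  have hlim := (hE.norm.inv₀ (by rw [hu]; exact one_ne_zero)).smul hE
  rw [hu, inv_one, one_smul] at hlim
  refine hlim.congr' ?_
  filter_upwards [self_mem_nhdsWithin] with t ht
  have h0 : 0 < τ - t := sub_pos.mpr ht
  rw [norm_smul, Real.norm_of_nonneg h0.le, smul_smul, _root_.mul_inv_rev, mul_assoc,
    inv_mul_cancel₀ h0.ne', mul_one]

theorem IsSolution.strictBalance (h : IsSolution v b τ V W) (hτ : 0 < τ) (hb : b.IsSymm)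
    (hku : KernelPair v.ofLp b τ k u) (hu : ∀ i, u i ≠ 0) : StrictBalance τ W := by
  intro i j l
  refine ⟨⊤, EReal.zero_lt_top, ?_⟩
  rw [timeTo_coe, EReal.tendsto_coe_nhds_top_iff]
  have hW : ∀ i j, Tendsto (fun t => (τ - t) * W t i j) (𝓝[<] τ) (𝓝 (u i * u j)) := fun i j =>
    (((continuous_id.matrix_elem i j)).tendsto _).comp (h.tendsto_smul_W hτ hb hku)
  have hp := ((hW i j).mul (hW j l)).mul (hW l i)
  have hpos : 0 < u i * u j * (u j * u l) * (u l * u i) := by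
    have : u i * u j * (u j * u l) * (u l * u i) = (u i * u j * u l) ^ 2 := by ring
    rw [this]
    exact sq_pos_of_ne_zero (mul_ne_zero (mul_ne_zero (hu i) (hu j)) (hu l))
  have hinv : Tendsto (fun t => ((τ - t) ^ 3)⁻¹) (𝓝[<] τ) atTop := by
    refine tendsto_inv_nhdsGT_zero.comp (tendsto_nhdsWithin_iff.mpr ⟨?_, ?_⟩)
    · simpa using (tendsto_sub_left τ).pow 3
    · filter_upwards [self_mem_nhdsWithin] with t ht
      have h0 : 0 < τ - t := sub_pos.mpr ht
      exact pow_pos h0 3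
  refine (hinv.atTop_mul_pos hpos hp).congr' ?_
  filter_upwards [self_mem_nhdsWithin] with t ht
  have h0 : τ - t ≠ 0 := (sub_pos.mpr ht).ne'
  field_simp

end FiniteTime

section InfiniteTime

open scoped Matrix.Norms.Operator

variable {n : ℕ}

/-! ### Scalar inequalities for global solutions -/

/-- A differential inequality `g' ≥ a g² - c` with `a > 0` forces blow-up once `g` is large, so
that a global nondecreasing solution is bounded above. -/
theorem exists_le_of_riccati_inequality {g g' : ℝ → ℝ} {a c : ℝ} (ha : 0 < a)
    (hcont : ContinuousOn g (Set.Ici 0)) (hd : ∀ t, 0 < t → HasDerivAt g (g' t) t)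
    (hmono : MonotoneOn g (Set.Ici 0)) (hg : ∀ t, 0 < t → a * g t ^ 2 - c ≤ g' t) :
    ∃ M, ∀ t, 0 ≤ t → g t ≤ M := by
  refine ⟨1 + 2 * |c| / a, fun s hs => ?_⟩
  by_contra! hlt
  have hca : 0 ≤ 2 * |c| / a := by positivity
  have hgs : 0 < g s := by linarith
  have hge : ∀ t, s ≤ t → g s ≤ g t := fun t ht => hmono hs (hs.trans ht : (0 : ℝ) ≤ t) ht
  -- Above the threshold `-1 / g` grows at least at the rate `a / 2`, yet it stays negative.
  have hder : ∀ t, s < t → HasDerivAt (fun r => -(g r)⁻¹) (g' t / g t ^ 2) t := by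
    intro t ht
    have := ((hd t (hs.trans_lt ht)).inv (hgs.trans_le (hge t ht.le)).ne').neg
    exact this.congr_deriv (by ring)
  have hrate : ∀ t, s < t → a / 2 ≤ g' t / g t ^ 2 := by
    intro t ht
    have h1 := hge t ht.le
    have h2 := hg t (hs.trans_lt ht)
    have h3 : |c| ≤ a / 2 * g t ^ 2 := by
      have h4 : 2 * |c| / a ≤ g t ^ 2 := by nlinarith
      rw [div_le_iff₀ ha] at h4
      linarith
    rw [le_div_iff₀ (by nlinarith)]
    linarith [le_abs_self c]
  have key := Convex.mul_sub_le_image_sub_of_le_deriv (convex_Ici s)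
    (f := fun r => -(g r)⁻¹) (C := a / 2)
    ((hcont.mono (Set.Ici_subset_Ici.mpr hs)).inv₀
      (fun t ht => (hgs.trans_le (hge t ht)).ne')).neg
    (by
      rw [interior_Ici]
      exact fun t ht => (hder t ht).differentiableAt.differentiableWithinAt)
    (by
      rw [interior_Ici]
      intro t ht
      rw [(hder t ht).deriv]
      exact hrate t ht)
    s Set.self_mem_Ici (s + 2 / (a * g s)) (by
      have : 0 < 2 / (a * g s) := by positivity
      exact (le_add_iff_nonneg_right s).mpr this.le) (by
      have : 0 < 2 / (a * g s) := by positivity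
      linarith)
  have hneg : 0 < (g (s + 2 / (a * g s)))⁻¹ := by
    refine inv_pos.mpr (hgs.trans_le (hge _ ?_))
    have : 0 < 2 / (a * g s) := by positivity
    linarith
  have e : a / 2 * (s + 2 / (a * g s) - s) = (g s)⁻¹ := by
    field_simp
    ring
  rw [e] at key
  linarith

theorem exists_tendsto_of_monotoneOn {g : ℝ → ℝ} {M : ℝ} (hmono : MonotoneOn g (Set.Ici 0))
    (hM : ∀ t, 0 ≤ t → g t ≤ M) : ∃ L, Tendsto g atTop (𝓝 L) := by
  have hm : Monotone fun t => g (max 0 t) := fun s t hst =>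
    hmono (Set.mem_Ici.mpr (le_max_left _ _)) (Set.mem_Ici.mpr (le_max_left _ _))
      (max_le_max le_rfl hst)
  have hb : BddAbove (Set.range fun t => g (max 0 t)) :=
    ⟨M, by rintro _ ⟨t, rfl⟩; exact hM _ (le_max_left _ _)⟩
  refine ⟨_, (tendsto_atTop_ciSup hm hb).congr' ?_⟩
  filter_upwards [eventually_ge_atTop 0] with t ht
  rw [max_eq_right ht]

/-- If a function and its derivative both converge at infinity, the derivative tends to zero. -/
theorem deriv_limit_eq_zero {f f' : ℝ → ℝ} {L l : ℝ} (hd : ∀ t, 0 < t → HasDerivAt f (f' t) t)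
    (hf : Tendsto f atTop (𝓝 L)) (hf' : Tendsto f' atTop (𝓝 l)) : l = 0 := by
  have hex : ∀ t : ℝ, ∃ ξ, t < ξ ∧ (0 < t → f' ξ = f (t + 1) - f t) := by
    intro t
    by_cases ht : 0 < t
    · obtain ⟨ξ, hξ, he⟩ := exists_hasDerivAt_eq_slope f f' (lt_add_one t)
        (fun s hs => (hd s (ht.trans_le hs.1)).continuousAt.continuousWithinAt)
        (fun s hs => hd s (ht.trans hs.1))
      exact ⟨ξ, hξ.1, fun _ => by rw [he]; simp⟩
    · exact ⟨t + 1, lt_add_one t, fun h => absurd h ht⟩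
  choose ξ hξ he using hex
  have hξt : Tendsto ξ atTop atTop := tendsto_atTop_mono (fun t => (hξ t).le) tendsto_id
  have h1 : Tendsto (fun t => f (t + 1) - f t) atTop (𝓝 (L - L)) :=
    (hf.comp (tendsto_atTop_add_const_right _ 1 tendsto_id)).sub hf
  rw [sub_self] at h1
  refine tendsto_nhds_unique (hf'.comp hξt) (h1.congr' ?_)
  filter_upwards [eventually_gt_atTop 0] with t ht
  exact (he t ht).symm

/-- Backward uniqueness from Grönwall's inequality. -/
theorem eq_zero_of_norm_deriv_le_left {E : Type*} [NormedAddCommGroup E] [NormedSpace ℝ E]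
    {g g' : ℝ → E} {K r : ℝ} (hr : 0 ≤ r) (hcont : ContinuousOn g (Set.Icc 0 r))
    (hd : ∀ t, 0 < t → HasDerivAt g (g' t) t)
    (hK : ∀ t ∈ Set.Icc 0 r, ‖g' t‖ ≤ K * ‖g t‖) (h0 : g r = 0) : g 0 = 0 := by
  have h := eq_zero_of_abs_deriv_le_mul_abs_self_of_eq_zero_right (f := fun s => g (r - s))
    (f' := fun s => -g' (r - s)) (K := K) (a := 0) (b := r)
    (hcont.comp (by fun_prop) fun s hs => ⟨by linarith [hs.2], by linarith [hs.1]⟩)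
    (fun s hs => by
      have := (hd (r - s) (by linarith [hs.2])).scomp s ((hasDerivAt_id s).const_sub r)
      exact (this.congr_deriv (by simp)).hasDerivWithinAt)
    (by simpa using h0)
    (fun s hs => by
      rw [norm_neg]
      exact hK _ ⟨by linarith [hs.2], by linarith [hs.1]⟩) r ⟨hr, le_rfl⟩
  simpa using h

/-- The Cauchy-Schwarz inequality of a positive semidefinite form, summed over the coordinates. -/
theorem mulVec_dotProduct_self_le {D : Matrix (Fin n) (Fin n) ℝ} (hD : D.IsSymm)
    (hpos : ∀ y, 0 ≤ y ⬝ᵥ (D *ᵥ y)) (x : Fin n → ℝ) :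
    (D *ᵥ x) ⬝ᵥ (D *ᵥ x) ≤ D.trace * (x ⬝ᵥ (D *ᵥ x)) := by
  have hcs : ∀ y, (y ⬝ᵥ (D *ᵥ x)) ^ 2 ≤ (y ⬝ᵥ (D *ᵥ y)) * (x ⬝ᵥ (D *ᵥ x)) := by
    intro y
    have hxy : x ⬝ᵥ (D *ᵥ y) = y ⬝ᵥ (D *ᵥ x) := by
      rw [dotProduct_mulVec, ← mulVec_transpose, hD.eq, dotProduct_comm]
    have := discrim_le_zero (a := x ⬝ᵥ (D *ᵥ x)) (b := 2 * (y ⬝ᵥ (D *ᵥ x)))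
      (c := y ⬝ᵥ (D *ᵥ y)) (fun s => by
        have h := hpos (s • x + y)
        simp only [mulVec_add, mulVec_smul, dotProduct_add, add_dotProduct, smul_dotProduct,
          dotProduct_smul, smul_eq_mul, hxy] at h
        linarith)
    rw [discrim] at this
    linarith
  have hi : ∀ i, (D *ᵥ x) i * (D *ᵥ x) i ≤ D i i * (x ⬝ᵥ (D *ᵥ x)) := by
    intro i
    have := hcs (Pi.single i 1)
    simpa [sq] using this
  calc (D *ᵥ x) ⬝ᵥ (D *ᵥ x) ≤ ∑ i, D i i * (x ⬝ᵥ (D *ᵥ x)) := Finset.sum_le_sum fun i _ => hi i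
    _ = D.trace * (x ⬝ᵥ (D *ᵥ x)) := by rw [← Finset.sum_mul]; rfl

/-- A symmetric matrix with a positive diagonal entry has a positive eigenvalue. -/
theorem exists_pos_eigenvalue {A : Matrix (Fin n) (Fin n) ℝ} (hA : A.IsSymm) {i : Fin n}
    (hi : 0 < A i i) : ∃ (μ : ℝ) (x : Fin n → ℝ), 0 < μ ∧ x ≠ 0 ∧ A *ᵥ x = μ • x := by
  have hH : (-A).IsHermitian := by
    rw [IsHermitian, conjTranspose_eq_transpose_of_trivial, transpose_neg, hA.eq]
  have hn : ¬ (-A).PosSemidef := fun h => by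
    have : 0 ≤ -(A i i) := h.diag_nonneg (i := i)
    linarith
  rw [hH.posSemidef_iff_eigenvalues_nonneg, Pi.le_def] at hn
  push Not at hn
  obtain ⟨j, hj⟩ := hn
  refine ⟨-hH.eigenvalues j, (hH.eigenvectorBasis j).ofLp, by simpa using hj, ?_, ?_⟩
  · intro h0
    have := hH.eigenvectorBasis.orthonormal.ne_zero j
    exact this (by ext l; exact congrFun h0 l)
  · have := hH.mulVec_eigenvectorBasis j
    rw [neg_mulVec] at this
    rw [neg_smul, ← this, neg_neg]

end InfiniteTime

section GlobalSolution

open scoped Matrix.Norms.Operator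

variable {n : ℕ}

/-! ### Global solutions -/

theorem mem_timeInterval_top {t : ℝ} (ht : 0 ≤ t) : t ∈ timeInterval ⊤ :=
  ⟨ht, EReal.coe_lt_top t⟩

theorem timeInterval_top : timeInterval ⊤ = Set.Ici 0 :=
  Set.Subset.antisymm (fun _ h => h.1) fun _ h => mem_timeInterval_top h

/-- Evaluation of the bilinear form of a matrix, as a linear function of the matrix. -/
def bilinEval (x y : Fin n → ℝ) : Matrix (Fin n) (Fin n) ℝ →ₗ[ℝ] ℝ where
  toFun A := x ⬝ᵥ (A *ᵥ y)
  map_add' A B := by rw [add_mulVec, dotProduct_add]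
  map_smul' c A := by rw [smul_mulVec, dotProduct_smul, RingHom.id_apply]

theorem bilinEval_apply (x y : Fin n → ℝ) (A : Matrix (Fin n) (Fin n) ℝ) :
    bilinEval x y A = x ⬝ᵥ (A *ᵥ y) := rfl

theorem bilinEval_vecMulVec (x y z : Fin n → ℝ) :
    bilinEval x y (vecMulVec z z) = (x ⬝ᵥ z) * (y ⬝ᵥ z) := by
  rw [bilinEval_apply, vecMulVec_mulVec]
  simp [dotProduct_smul, dotProduct_comm z y, mul_comm]

variable {v : EuclideanSpace ℝ (Fin n)} {b : Matrix (Fin n) (Fin n) ℝ}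
  {V : ℝ → EuclideanSpace ℝ (Fin n)} {W : ℝ → Matrix (Fin n) (Fin n) ℝ}

namespace IsSolution

theorem hasDerivAt_V (h : IsSolution v b ⊤ V W) {t : ℝ} (ht : 0 < t) :
    HasDerivAt (fun s => (V s).ofLp) (W t *ᵥ (V t).ofLp) t :=
  (h.hasDeriv_V (mem_timeInterval_top ht.le)).hasDerivAt
    (timeInterval_mem_nhds (mem_timeInterval_top ht.le) ht)

theorem hasDerivAt_W (h : IsSolution v b ⊤ V W) {t : ℝ} (ht : 0 < t) :
    HasDerivAt W (vecMulVec (V t).ofLp (V t).ofLp) t :=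
  (h.hasDeriv_W (mem_timeInterval_top ht.le)).hasDerivAt
    (timeInterval_mem_nhds (mem_timeInterval_top ht.le) ht)

theorem continuousOn_W (h : IsSolution v b ⊤ V W) : ContinuousOn W (Set.Ici 0) := by
  rw [← timeInterval_top]
  exact fun t ht => (h.hasDeriv_W ht).continuousWithinAt

theorem continuousOn_V (h : IsSolution v b ⊤ V W) :
    ContinuousOn (fun s => (V s).ofLp) (Set.Ici 0) := by
  rw [← timeInterval_top]
  exact fun t ht => (h.hasDeriv_V ht).continuousWithinAt

theorem hasDerivAt_bilinEval (h : IsSolution v b ⊤ V W) (x y : Fin n → ℝ) {t : ℝ} (ht : 0 < t) :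
    HasDerivAt (fun s => bilinEval x y (W s)) ((x ⬝ᵥ (V t).ofLp) * (y ⬝ᵥ (V t).ofLp)) t :=
  ((h.hasDerivAt_W ht).linearMap_comp (bilinEval x y)).congr_deriv (bilinEval_vecMulVec _ _ _)

theorem continuousOn_bilinEval (h : IsSolution v b ⊤ V W) (x y : Fin n → ℝ) :
    ContinuousOn (fun s => bilinEval x y (W s)) (Set.Ici 0) :=
  (LinearMap.continuous_of_finiteDimensional (bilinEval x y)).comp_continuousOn h.continuousOn_W

theorem monotoneOn_bilinEval_self (h : IsSolution v b ⊤ V W) (x : Fin n → ℝ) :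
    MonotoneOn (fun s => bilinEval x x (W s)) (Set.Ici 0) := by
  refine monotoneOn_of_deriv_nonneg (convex_Ici 0) (h.continuousOn_bilinEval x x) ?_ ?_
  · rw [interior_Ici]
    exact fun t ht => (h.hasDerivAt_bilinEval x x ht).differentiableAt.differentiableWithinAt
  · rw [interior_Ici]
    intro t ht
    rw [(h.hasDerivAt_bilinEval x x ht).deriv]
    exact mul_self_nonneg _

/-- The conservation law, evaluated on a vector. -/
theorem dot_V_sq (h : IsSolution v b ⊤ V W) (hb : b.IsSymm) (x : Fin n → ℝ) {t : ℝ}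
    (ht : 0 ≤ t) : (x ⬝ᵥ (V t).ofLp) * (x ⬝ᵥ (V t).ofLp)
      = (W t *ᵥ x) ⬝ᵥ (W t *ᵥ x) - bilinEval x x (invariant v.ofLp b) := by
  rw [← h.sq_sub_vecMulVec hb (mem_timeInterval_top ht), map_sub, bilinEval_vecMulVec,
    bilinEval_apply, ← mulVec_mulVec, dotProduct_mulVec, ← mulVec_transpose,
    (h.isSymm hb (mem_timeInterval_top ht)).eq, dotProduct_comm _ x]
  ring

theorem exists_tendsto_bilinEval_self (h : IsSolution v b ⊤ V W) (hb : b.IsSymm)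
    (x : Fin n → ℝ) : ∃ L, Tendsto (fun t => bilinEval x x (W t)) atTop (𝓝 L) := by
  have hx : 0 ≤ x ⬝ᵥ x := Finset.sum_nonneg fun i _ => mul_self_nonneg (x i)
  obtain ⟨M, hM⟩ := exists_le_of_riccati_inequality (a := (1 + x ⬝ᵥ x)⁻¹)
    (c := bilinEval x x (invariant v.ofLp b)) (by positivity) (h.continuousOn_bilinEval x x)
    (fun t ht => h.hasDerivAt_bilinEval x x ht) (h.monotoneOn_bilinEval_self x) (by
      intro t ht
      rw [h.dot_V_sq hb x ht.le]
      have hcs : (bilinEval x x (W t)) ^ 2 ≤ (x ⬝ᵥ x) * ((W t *ᵥ x) ⬝ᵥ (W t *ᵥ x)) := by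
        have := Finset.sum_mul_sq_le_sq_mul_sq Finset.univ x (W t *ᵥ x)
        simpa only [bilinEval_apply, dotProduct, sq] using this
      have hW : 0 ≤ (W t *ᵥ x) ⬝ᵥ (W t *ᵥ x) := Finset.sum_nonneg fun i _ => mul_self_nonneg _
      have : (1 + x ⬝ᵥ x)⁻¹ * (bilinEval x x (W t)) ^ 2 ≤ (W t *ᵥ x) ⬝ᵥ (W t *ᵥ x) := by
        rw [inv_mul_le_iff₀ (by positivity)]
        nlinarith
      linarith)
  exact exists_tendsto_of_monotoneOn (h.monotoneOn_bilinEval_self x) hM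

/-- A global solution has a convergent `W`: its quadratic forms are nondecreasing and bounded. -/
theorem exists_tendsto_W (h : IsSolution v b ⊤ V W) (hb : b.IsSymm) :
    ∃ A, Tendsto W atTop (𝓝 A) := by
  choose L hL using h.exists_tendsto_bilinEval_self hb
  refine ⟨Matrix.of fun i j => (L (Pi.single i 1 + Pi.single j 1) - L (Pi.single i 1)
    - L (Pi.single j 1)) / 2, ?_⟩
  refine tendsto_pi_nhds.mpr fun i => tendsto_pi_nhds.mpr fun j => ?_
  refine ((((hL (Pi.single i 1 + Pi.single j 1)).sub (hL (Pi.single i 1))).sub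
    (hL (Pi.single j 1))).div_const 2).congr' ?_
  filter_upwards [eventually_ge_atTop 0] with t ht
  have hs := (h.isSymm hb (mem_timeInterval_top ht)).apply i j
  simp only [bilinEval_apply, mulVec_add, dotProduct_add, add_dotProduct]
  simp only [mulVec_single_one, single_one_dotProduct, col_apply]
  rw [hs]
  ring

theorem tendsto_V (h : IsSolution v b ⊤ V W) (hb : b.IsSymm) :
    Tendsto (fun t => (V t).ofLp) atTop (𝓝 0) := by
  obtain ⟨A, hA⟩ := h.exists_tendsto_W hb
  refine tendsto_pi_nhds.mpr fun i => ?_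
  have hWii : Tendsto (fun t => W t i i) atTop (𝓝 (A i i)) :=
    ((continuous_id.matrix_elem i i).tendsto A).comp hA
  have hsq : Tendsto (fun t => V t i * V t i) atTop
      (𝓝 ((A * A - invariant v.ofLp b) i i)) := by
    have := ((continuous_id.matrix_elem i i).tendsto _).comp
      ((hA.mul hA).sub_const (invariant v.ofLp b))
    refine this.congr' ?_
    filter_upwards [eventually_ge_atTop 0] with t ht
    rw [← h.sq_sub_vecMulVec hb (mem_timeInterval_top ht)]
    simp [vecMulVec_apply]
  have h0 : (A * A - invariant v.ofLp b) i i = 0 := by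
    refine deriv_limit_eq_zero (f := fun t => W t i i) (fun t ht => ?_) hWii hsq
    exact (h.deriv_W t (mem_timeInterval_top ht.le) i i).hasDerivAt
      (timeInterval_mem_nhds (mem_timeInterval_top ht.le) ht)
  rw [h0] at hsq
  have := hsq.sqrt
  simp only [Real.sqrt_mul_self_eq_abs, Real.sqrt_zero] at this
  exact (tendsto_zero_iff_abs_tendsto_zero _).mpr this

/-- A global solution has vanishing opinions, for all initial data. -/
theorem opinionsVanish (h : IsSolution v b ⊤ V W) (hb : b.IsSymm) : OpinionsVanish ⊤ V := by
  obtain ⟨A, hA⟩ := h.exists_tendsto_W hb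
  have hV := h.tendsto_V hb
  have hV' : Tendsto V atTop (𝓝 0) :=
    ((PiLp.continuous_toLp 2 (fun _ : Fin n => ℝ)).tendsto 0).comp hV
  refine ⟨rfl, by simpa using hV'.norm, ?_⟩
  have hlim : Tendsto (fun t => WithLp.toLp 2 (W t *ᵥ (V t).ofLp)) atTop (𝓝 0) := by
    have := ((continuous_fst.matrix_mulVec continuous_snd).tendsto (A, (0 : Fin n → ℝ))).comp
      (hA.prodMk_nhds hV)
    rw [mulVec_zero] at this
    exact ((PiLp.continuous_toLp 2 (fun _ : Fin n => ℝ)).tendsto 0).comp this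
  refine hlim.congr' ?_
  filter_upwards [eventually_gt_atTop 0] with t ht
  exact ((h.hasDerivAt_V ht).linearMap_comp
    (WithLp.linearEquiv 2 ℝ (Fin n → ℝ)).symm.toLinearMap).deriv.symm

/-- If at some time `W x = μ x` and `V` is orthogonal to `x`, then so it was initially. -/
theorem eigenvector_initial (h : IsSolution v b ⊤ V W) {r μ : ℝ} (hb : b.IsSymm)
    (hr : 0 ≤ r) {x : Fin n → ℝ} (hW : W r *ᵥ x = μ • x) (hV : (V r).ofLp ⬝ᵥ x = 0) :
    b *ᵥ x = μ • x ∧ v.ofLp ⬝ᵥ x = 0 := by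
  set p : ℝ → Fin n → ℝ := fun t => W t *ᵥ x - μ • x with hp
  set f : ℝ → ℝ := fun t => (V t).ofLp ⬝ᵥ x with hf
  have hpd : ∀ t, 0 < t → HasDerivAt p (f t • (V t).ofLp) t := by
    intro t ht
    refine (((h.hasDerivAt_W ht).linearMap_comp ((mulVecBilin ℝ ℝ).flip x)).sub_const
      (μ • x)).congr_deriv ?_
    simp [vecMulVec_mulVec, hf]
  have hfd : ∀ t, 0 < t → HasDerivAt f ((V t).ofLp ⬝ᵥ p t + μ * f t) t := by
    intro t ht
    have hVi := hasDerivAt_pi.mp (h.hasDerivAt_V ht)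
    refine (HasDerivAt.fun_sum fun i (_ : i ∈ Finset.univ) =>
      (hVi i).mul_const (x i)).congr_deriv ?_
    have e : ∑ i, (W t *ᵥ (V t).ofLp) i * x i = (W t *ᵥ (V t).ofLp) ⬝ᵥ x := rfl
    rw [e, hp, dotProduct_sub, dotProduct_smul, dotProduct_mulVec, ← mulVec_transpose,
      (h.isSymm hb (mem_timeInterval_top ht.le)).eq]
    simp [hf]
  have hVc : ContinuousOn (fun t => (V t).ofLp) (Set.Icc 0 r) :=
    h.continuousOn_V.mono Set.Icc_subset_Ici_self
  have hWc : ContinuousOn W (Set.Icc 0 r) := h.continuousOn_W.mono Set.Icc_subset_Ici_self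
  have hVi : ∀ i, ContinuousOn (fun t => V t i) (Set.Icc 0 r) := continuousOn_pi.mp hVc
  have hbd : ContinuousOn (fun t => ‖(V t).ofLp‖ + (∑ i, |V t i|) + |μ|) (Set.Icc 0 r) :=
    (hVc.norm.add (continuousOn_finsetSum _ fun i _ => (hVi i).abs)).add continuousOn_const
  obtain ⟨K, hK⟩ := isCompact_Icc.bddAbove_image hbd
  have hpc : ContinuousOn p (Set.Icc 0 r) :=
    (((continuous_id.matrix_mulVec continuous_const).comp_continuousOn hWc)).sub
      continuousOn_const
  have hfc : ContinuousOn f (Set.Icc 0 r) :=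
    continuousOn_finsetSum _ fun i _ => (hVi i).mul continuousOn_const
  have h0 := eq_zero_of_norm_deriv_le_left (g := fun t => (p t, f t))
    (g' := fun t => (f t • (V t).ofLp, (V t).ofLp ⬝ᵥ p t + μ * f t)) (K := K) hr
    (hpc.prodMk hfc) (fun t ht => (hpd t ht).prodMk (hfd t ht)) (by
      intro t ht
      have hKt : ‖(V t).ofLp‖ + (∑ i, |V t i|) + |μ| ≤ K := hK ⟨t, ht, rfl⟩
      have hS : 0 ≤ ∑ i, |V t i| := Finset.sum_nonneg fun i _ => abs_nonneg _
      have hg1 : ‖p t‖ ≤ ‖(p t, f t)‖ := norm_fst_le (p t, f t)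
      have hg2 : |f t| ≤ ‖(p t, f t)‖ := norm_snd_le (p t, f t)
      have hg0 := norm_nonneg (p t, f t)
      refine norm_prod_le_iff.mpr ⟨?_, ?_⟩
      · rw [norm_smul, Real.norm_eq_abs, mul_comm]
        refine mul_le_mul ?_ hg2 (abs_nonneg _) ?_
        · linarith [abs_nonneg μ]
        · linarith [abs_nonneg μ, norm_nonneg (V t).ofLp]
      · have h1 : |(V t).ofLp ⬝ᵥ p t| ≤ (∑ i, |V t i|) * ‖p t‖ := by
          rw [Finset.sum_mul]
          refine (Finset.abs_sum_le_sum_abs _ _).trans (Finset.sum_le_sum fun i _ => ?_)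
          rw [abs_mul]
          exact mul_le_mul_of_nonneg_left (norm_le_pi_norm (p t) i) (abs_nonneg _)
        calc ‖(V t).ofLp ⬝ᵥ p t + μ * f t‖ ≤ |(V t).ofLp ⬝ᵥ p t| + |μ| * |f t| := by
              rw [← abs_mul]; exact abs_add_le _ _
          _ ≤ (∑ i, |V t i|) * ‖(p t, f t)‖ + |μ| * ‖(p t, f t)‖ :=
              add_le_add (h1.trans (mul_le_mul_of_nonneg_left hg1 hS))
                (mul_le_mul_of_nonneg_left hg2 (abs_nonneg _))
          _ ≤ K * ‖(p t, f t)‖ := by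
              rw [← add_mul]
              exact mul_le_mul_of_nonneg_right (by linarith [norm_nonneg (V t).ofLp]) hg0)
    (by
      change (W r *ᵥ x - μ • x, (V r).ofLp ⬝ᵥ x) = 0
      rw [hW, hV, sub_self]; rfl)
  have h1 : W 0 *ᵥ x - μ • x = 0 := congrArg Prod.fst h0
  have h2 : (V 0).ofLp ⬝ᵥ x = 0 := congrArg Prod.snd h0
  rw [h.initial_W] at h1
  rw [h.initial_V] at h2
  exact ⟨sub_eq_zero.mp h1, h2⟩

/-- If the limit `A` of `W` has an eigenvector `x` with an eigenvalue `μ > 0`, then `x` is an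
eigenvector of `b` orthogonal to `v`. The defect `D = A - W` is positive semidefinite and tends to
zero; the conservation law gives `|D x|² = 2 μ xᵀDx + (x · V)²`, while `|D x|² ≤ tr(D) xᵀDx`. So
`D x = 0` and `x · V = 0` once `tr(D) < μ`. -/
theorem eigenvector_of_limit (h : IsSolution v b ⊤ V W) (hb : b.IsSymm)
    {A : Matrix (Fin n) (Fin n) ℝ} (hA : Tendsto W atTop (𝓝 A)) {μ : ℝ} (hμ : 0 < μ)
    {x : Fin n → ℝ} (hx : A *ᵥ x = μ • x) : b *ᵥ x = μ • x ∧ v.ofLp ⬝ᵥ x = 0 := by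
  have hAs : A.IsSymm := by
    refine tendsto_nhds_unique (((continuous_id.matrix_transpose).tendsto A).comp hA)
      (hA.congr' ?_)
    filter_upwards [eventually_ge_atTop 0] with t ht
    exact (h.isSymm hb (mem_timeInterval_top ht)).eq.symm
  have hC : A * A = invariant v.ofLp b := by
    have h1 : Tendsto (fun t => W t * W t - vecMulVec (V t).ofLp (V t).ofLp) atTop
        (𝓝 (A * A - vecMulVec 0 0)) :=
      (hA.mul hA).sub (((continuous_id.matrix_vecMulVec continuous_id).tendsto
        (0 : Fin n → ℝ)).comp (h.tendsto_V hb))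
    rw [vecMulVec_zero, sub_zero] at h1
    refine tendsto_nhds_unique h1 (tendsto_const_nhds.congr' ?_)
    filter_upwards [eventually_ge_atTop 0] with t ht
    exact (h.sq_sub_vecMulVec hb (mem_timeInterval_top ht)).symm
  have hpos : ∀ t, 0 ≤ t → ∀ y, 0 ≤ y ⬝ᵥ ((A - W t) *ᵥ y) := by
    intro t ht y
    have hl : Tendsto (fun s => bilinEval y y (W s)) atTop (𝓝 (bilinEval y y A)) :=
      ((LinearMap.continuous_of_finiteDimensional (bilinEval y y)).tendsto A).comp hA
    have : bilinEval y y (W t) ≤ bilinEval y y A := by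
      refine ge_of_tendsto hl ?_
      filter_upwards [eventually_ge_atTop t] with s hs
      exact h.monotoneOn_bilinEval_self y ht (ht.trans hs : (0 : ℝ) ≤ s) hs
    rw [← bilinEval_apply, map_sub]
    linarith
  have htr : Tendsto (fun t => (A - W t).trace) atTop (𝓝 0) := by
    have : Tendsto (fun t => (A - W t).trace) atTop (𝓝 (A - A).trace) :=
      ((continuous_id.matrix_trace).tendsto (A - A)).comp (hA.const_sub A)
    rwa [sub_self, trace_zero] at this
  obtain ⟨r, hr, hr0⟩ := ((htr.eventually_lt_const hμ).and (eventually_ge_atTop 0)).exists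
  have hWs := h.isSymm hb (mem_timeInterval_top hr0)
  have hcs := mulVec_dotProduct_self_le (hAs.sub hWs) (hpos r hr0) x
  have hd := hpos r hr0 x
  set D := A - W r with hD
  have hWx : W r *ᵥ x = μ • x - D *ᵥ x := by rw [hD, sub_mulVec, hx, sub_sub_cancel]
  have hen := h.dot_V_sq hb x hr0
  have hCx : bilinEval x x (invariant v.ofLp b) = μ * (μ * (x ⬝ᵥ x)) := by
    rw [← hC, bilinEval_apply, ← mulVec_mulVec, hx, mulVec_smul, hx]
    simp
  rw [hCx, hWx] at hen
  simp only [sub_dotProduct, dotProduct_sub, smul_dotProduct, dotProduct_smul, smul_eq_mul,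
    dotProduct_comm (D *ᵥ x) x] at hen
  have hsq := mul_self_nonneg (x ⬝ᵥ (V r).ofLp)
  have hDD : 0 ≤ (D *ᵥ x) ⬝ᵥ (D *ᵥ x) := Finset.sum_nonneg fun i _ => mul_self_nonneg _
  have hd0 : x ⬝ᵥ (D *ᵥ x) = 0 := by nlinarith
  rw [hd0] at hcs hen
  have hDx : D *ᵥ x = 0 := dotProduct_self_eq_zero.mp (le_antisymm (by simpa using hcs) hDD)
  refine h.eigenvector_initial hb hr0 (by rw [hWx, hDx, sub_zero]) ?_
  rw [hDx] at hen
  rw [dotProduct_comm]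
  refine mul_self_eq_zero.mp (hen.trans ?_)
  simp

/-- Strict balance of a global solution is exceptional: it forces `b` to have an eigenvector
orthogonal to `v`. -/
theorem exists_eigenvector_of_strictBalance (h : IsSolution v b ⊤ V W) (hb : b.IsSymm)
    (hn : 0 < n) (hbal : StrictBalance ⊤ W) :
    ∃ (μ : ℝ) (x : Fin n → ℝ), x ≠ 0 ∧ b *ᵥ x = μ • x ∧ v.ofLp ⬝ᵥ x = 0 := by
  obtain ⟨A, hA⟩ := h.exists_tendsto_W hb
  let i : Fin n := ⟨0, hn⟩
  obtain ⟨L, hL, hlim⟩ := hbal i i i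
  rw [timeTo_top] at hlim
  have hWii : Tendsto (fun t => W t i i) atTop (𝓝 (A i i)) :=
    ((continuous_id.matrix_elem i i).tendsto A).comp hA
  have h3 := (continuous_coe_real_ereal.tendsto _).comp ((hWii.mul hWii).mul hWii)
  have hAL : ((A i i * A i i * A i i : ℝ) : EReal) = L := tendsto_nhds_unique h3 hlim
  rw [← hAL] at hL
  have hpos : 0 < A i i := by
    have h0 := EReal.coe_pos.mp hL
    by_contra! hle
    have := mul_nonpos_of_nonneg_of_nonpos (mul_self_nonneg (A i i)) hle
    linarith
  have hAs : A.IsSymm := by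
    refine tendsto_nhds_unique (((continuous_id.matrix_transpose).tendsto A).comp hA)
      (hA.congr' ?_)
    filter_upwards [eventually_ge_atTop 0] with t ht
    exact (h.isSymm hb (mem_timeInterval_top ht)).eq.symm
  obtain ⟨μ, x, hμ, hx0, hx⟩ := exists_pos_eigenvalue hAs hpos
  exact ⟨μ, x, hx0, h.eigenvector_of_limit hb hA hμ hx⟩

end IsSolution

end GlobalSolution

section NullSets

variable {n : ℕ}

/-! ### Null sets of initial data -/

/-- The zero set of a continuous function is null if, along every line in a fixed direction, the
function is a nonzero polynomial. -/
theorem measure_zeroSet_eq_zero {E : Type*} [NormedAddCommGroup E] [NormedSpace ℝ E]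
    [FiniteDimensional ℝ E] [MeasurableSpace E] [BorelSpace E] (μ : Measure E)
    [μ.IsAddHaarMeasure] {f : E → ℝ} (hf : Continuous f) (d : E)
    (h : ∀ x, ∃ P : Polynomial ℝ, P ≠ 0 ∧ ∀ s : ℝ, P.eval s = f (x + s • d)) :
    μ {x | f x = 0} = 0 := by
  have hm : MeasurableSet {x | f x ≠ 0} :=
    (isClosed_singleton.preimage hf).isOpen_compl.measurableSet
  have key := ae_mem_of_ae_add_linearMap_mem (LinearMap.toSpanSingleton ℝ E d) volume μ hm (by
    intro y
    obtain ⟨P, hP, he⟩ := h y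
    have hfin : {s : ℝ | P.eval s = 0}.Finite := by
      refine (P.roots.toFinset.finite_toSet).subset fun s hs => ?_
      simpa [hP] using hs
    have h0 : volume {s : ℝ | P.eval s = 0} = 0 := hfin.measure_zero _
    filter_upwards [compl_mem_ae_iff.mpr h0] with s hs
    simpa [he] using hs)
  have hc : {x | f x = 0} = {x | f x ≠ 0}ᶜ := by ext; simp
  rw [hc]
  exact mem_ae_iff.mp key

/-- The Krylov matrix with the columns `v, b v, …, b^(n-1) v`. -/
def krylov {R : Type*} [CommRing R] (v : Fin n → R) (b : Matrix (Fin n) (Fin n) R) :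
    Matrix (Fin n) (Fin n) R :=
  Matrix.of fun i j => (b ^ (j : ℕ) *ᵥ v) i

/-- An eigenvector of `b` orthogonal to `v` makes the Krylov matrix singular. -/
theorem det_krylov_eq_zero {v : Fin n → ℝ} {b : Matrix (Fin n) (Fin n) ℝ} (hb : b.IsSymm)
    {μ : ℝ} {x : Fin n → ℝ} (hx0 : x ≠ 0) (hx : b *ᵥ x = μ • x) (hvx : v ⬝ᵥ x = 0) :
    (krylov v b).det = 0 := by
  refine exists_vecMul_eq_zero_iff.mp ⟨x, hx0, ?_⟩
  have hpow : ∀ m : ℕ, b ^ m *ᵥ x = μ ^ m • x := by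
    intro m
    induction m with
    | zero => simp
    | succ m ih => rw [pow_succ, ← mulVec_mulVec, hx, mulVec_smul, ih, smul_smul, pow_succ']
  ext j
  change x ⬝ᵥ (b ^ (j : ℕ) *ᵥ v) = 0
  have hs : (b ^ (j : ℕ))ᵀ = b ^ (j : ℕ) := by rw [transpose_pow, hb.eq]
  rw [dotProduct_mulVec, ← mulVec_transpose, hs, hpow, smul_dotProduct, dotProduct_comm, hvx,
    smul_zero]

theorem krylov_map {R S : Type*} [CommRing R] [CommRing S] (φ : R →+* S) (v : Fin n → R)
    (b : Matrix (Fin n) (Fin n) R) :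
    krylov (φ ∘ v) (b.map φ) = (krylov v b).map φ := by
  ext i j
  simp only [krylov, of_apply, map_apply]
  rw [RingHom.map_mulVec, ← RingHom.mapMatrix_apply, ← RingHom.mapMatrix_apply,
    map_pow]

theorem det_krylov_smul {R : Type*} [CommRing R] (s : R) (v : Fin n → R)
    (b : Matrix (Fin n) (Fin n) R) :
    (krylov (s • v) (s • b)).det = (∏ j : Fin n, s ^ ((j : ℕ) + 1)) * (krylov v b).det := by
  rw [← det_mul_row]
  congr 1
  ext i j
  simp only [krylov, of_apply]
  rw [smul_pow, mulVec_smul, smul_mulVec, smul_smul, Pi.smul_apply, smul_eq_mul, pow_succ']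

/-- The symmetric matrix `A` as a function on unordered pairs. -/
def toSym2 (A : Matrix (Fin n) (Fin n) ℝ) (hA : A.IsSymm) : Sym2 (Fin n) → ℝ :=
  Sym2.lift ⟨fun i j => A i j, fun i j => hA.apply j i⟩

theorem symMatrix_isSymm (b : Sym2 (Fin n) → ℝ) : (symMatrix b).IsSymm := by
  ext i j
  simp [symMatrix, Sym2.eq_swap]

theorem continuous_symMatrix : Continuous (symMatrix : (Sym2 (Fin n) → ℝ) → _) :=
  continuous_pi fun _ => continuous_pi fun _ => continuous_apply _

theorem continuous_det_krylov : Continuous fun q : (Fin n → ℝ) × Matrix (Fin n) (Fin n) ℝ =>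
    (krylov q.1 q.2).det := by
  refine Continuous.matrix_det (continuous_pi fun i => continuous_pi fun j => ?_)
  exact (continuous_apply i).comp ((continuous_snd.pow (j : ℕ)).matrix_mulVec continuous_fst)

theorem continuous_det_krylov_data : Continuous fun p : InitialData n =>
    (krylov p.1.ofLp (symMatrix p.2)).det :=
  continuous_det_krylov.comp (((PiLp.continuous_ofLp 2 _).comp continuous_fst).prodMk
    (continuous_symMatrix.comp continuous_snd))

theorem isSymm_diagonal (d : Fin n → ℝ) : (diagonal d).IsSymm := diagonal_transpose d

/-- Along a line whose direction has a nonsingular Krylov matrix, the Krylov determinant is a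
nonzero polynomial. -/
theorem exists_polynomial_det_krylov (v w : Fin n → ℝ) (b c : Matrix (Fin n) (Fin n) ℝ)
    (h : (krylov w c).det ≠ 0) : ∃ P : Polynomial ℝ, P ≠ 0 ∧
      ∀ s : ℝ, P.eval s = (krylov (v + s • w) (b + s • c)).det := by
  let P : Polynomial ℝ := (krylov
    (fun i => Polynomial.C (v i) + Polynomial.X * Polynomial.C (w i))
    (b.map Polynomial.C + (Polynomial.X : Polynomial ℝ) • c.map Polynomial.C)).det
  have heval : ∀ s : ℝ, P.eval s = (krylov (v + s • w) (b + s • c)).det := by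
    intro s
    rw [← Polynomial.coe_evalRingHom (R := ℝ) s, RingHom.map_det, RingHom.mapMatrix_apply,
      ← krylov_map]
    congr 2
    · ext i
      simp
      exact mul_comm _ _
    · ext i j
      simp
      exact mul_comm _ _
  refine ⟨P, fun hP => ?_, heval⟩
  -- Far out on the line the determinant is dominated by its value at the direction.
  have hlim : Tendsto (fun s : ℝ => (krylov (s⁻¹ • v + w) (s⁻¹ • b + c)).det) atTop
      (𝓝 (krylov w c).det) := by
    have hc : Continuous fun r : ℝ => (krylov (r • v + w) (r • b + c)).det :=
      continuous_det_krylov.comp (((continuous_id.smul continuous_const).add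
        continuous_const).prodMk ((continuous_id.smul continuous_const).add continuous_const))
    have := (hc.tendsto 0).comp (tendsto_inv_atTop_zero (𝕜 := ℝ))
    rwa [zero_smul, zero_smul, zero_add, zero_add] at this
  obtain ⟨s, hs, hs0⟩ := ((hlim.eventually_ne h).and (eventually_gt_atTop 0)).exists
  have h1 := heval s
  have e1 : v + s • w = s • (s⁻¹ • v + w) := by
    rw [smul_add, smul_smul, mul_inv_cancel₀ hs0.ne', one_smul]
  have e2 : b + s • c = s • (s⁻¹ • b + c) := by
    rw [smul_add, smul_smul, mul_inv_cancel₀ hs0.ne', one_smul]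
  rw [hP, Polynomial.eval_zero, e1, e2, det_krylov_smul] at h1
  exact mul_ne_zero (Finset.prod_ne_zero_iff.mpr fun j _ => pow_ne_zero _ hs0.ne') hs h1.symm

instance isAddHaarMeasure_volume : (volume : Measure (InitialData n)).IsAddHaarMeasure :=
  Measure.prod.instIsAddHaarMeasure _ _

/-- For almost all initial data `v` is a cyclic vector of `b`. -/
theorem volume_det_krylov_eq_zero :
    volume {p : InitialData n | (krylov p.1.ofLp (symMatrix p.2)).det = 0} = 0 := by
  -- The direction `(1, diag(0, …, n - 1))` has a Vandermonde matrix as its Krylov matrix.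
  let w : Fin n → ℝ := fun i => (i : ℝ)
  have hd : (krylov (1 : Fin n → ℝ) (diagonal w)).det ≠ 0 := by
    have e : krylov 1 (diagonal w) = vandermonde w := by
      ext i j
      simp [krylov, diagonal_pow, mulVec_diagonal, vandermonde_apply]
    rw [e, det_vandermonde_ne_zero_iff]
    intro i j hij
    have hij' : (i : ℝ) = (j : ℝ) := hij
    exact Fin.ext (by exact_mod_cast hij')
  exact measure_zeroSet_eq_zero volume continuous_det_krylov_data
    (WithLp.toLp 2 1, toSym2 (diagonal w) (isSymm_diagonal w)) fun p =>
      exists_polynomial_det_krylov p.1.ofLp 1 (symMatrix p.2) (diagonal w) hd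

/-- For a nonzero vector `u`, the reflections `x` whose image of `u` has a vanishing `i`-th entry
form a null set; here this entry is multiplied by `x · x`. -/
theorem volume_reflection_entry_eq_zero {u : Fin n → ℝ} (hu : u ≠ 0) (i : Fin n) :
    volume {x : Fin n → ℝ | (x ⬝ᵥ x) * u i - 2 * x i * (x ⬝ᵥ u) = 0} = 0 := by
  set q : (Fin n → ℝ) → ℝ := fun x => (x ⬝ᵥ x) * u i - 2 * x i * (x ⬝ᵥ u) with hq
  have hqc : Continuous q := by
    simp only [hq, dotProduct]
    fun_prop
  obtain ⟨d, hd⟩ : ∃ d, q d ≠ 0 := by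
    by_cases hi : u i = 0
    · obtain ⟨j, hj⟩ := Function.ne_iff.mp hu
      have hij : j ≠ i := fun h => hj (by rw [h, hi]; rfl)
      refine ⟨Pi.single i 1 + Pi.single j 1, ?_⟩
      simp only [hq, hi, mul_zero, zero_sub, add_dotProduct, single_one_dotProduct, zero_add,
        Pi.add_apply, Pi.single_eq_same, Pi.single_eq_of_ne' hij]
      simpa using hj
    · refine ⟨Pi.single i 1, ?_⟩
      simp only [hq, single_one_dotProduct, Pi.single_eq_same]
      intro h
      apply hi
      linarith
  refine measure_zeroSet_eq_zero volume hqc d fun x => ?_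
  refine ⟨Polynomial.C (q d) * Polynomial.X ^ 2
    + Polynomial.C (2 * (x ⬝ᵥ d) * u i - 2 * x i * (d ⬝ᵥ u) - 2 * d i * (x ⬝ᵥ u)) * Polynomial.X
    + Polynomial.C (q x), fun h => hd ?_, fun s => ?_⟩
  · have := congrArg (fun P => Polynomial.coeff P 2) h
    simpa [Polynomial.coeff_X, Polynomial.coeff_C] using this
  · simp only [hq, Polynomial.eval_add, Polynomial.eval_mul, Polynomial.eval_C,
      Polynomial.eval_pow, Polynomial.eval_X, add_dotProduct, dotProduct_add, smul_dotProduct,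
      dotProduct_smul, smul_eq_mul, Pi.add_apply, Pi.smul_apply, dotProduct_comm d x]
    ring

end NullSets

section Reflections

open scoped Matrix.Norms.Operator

variable {n : ℕ}

/-! ### Orthogonal symmetry -/

/-- The reflection `1 - 2 x xᵀ / (x · x)`; for `x = 0` the convention `2 / 0 = 0` makes it the
identity, which is orthogonal as well. -/
noncomputable def reflection (x : Fin n → ℝ) : Matrix (Fin n) (Fin n) ℝ :=
  1 - (2 / (x ⬝ᵥ x)) • vecMulVec x x

theorem reflection_transpose (x : Fin n → ℝ) : (reflection x)ᵀ = reflection x := by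
  simp [reflection, transpose_vecMulVec]

theorem reflection_mulVec (x u : Fin n → ℝ) :
    reflection x *ᵥ u = u - (2 / (x ⬝ᵥ x) * (x ⬝ᵥ u)) • x := by
  rw [reflection, sub_mulVec, one_mulVec, smul_mulVec, vecMulVec_mulVec]
  simp [smul_smul]

theorem reflection_mul_self (x : Fin n → ℝ) : reflection x * reflection x = 1 := by
  rw [← Matrix.toLin'.injective.eq_iff]
  refine LinearMap.ext fun u => ?_
  rw [toLin'_apply, toLin'_apply, one_mulVec, ← mulVec_mulVec, reflection_mulVec,
    reflection_mulVec, dotProduct_sub, dotProduct_smul, smul_eq_mul]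
  by_cases h : x ⬝ᵥ x = 0
  · simp [h]
  · have : 2 / (x ⬝ᵥ x) * (x ⬝ᵥ u - 2 / (x ⬝ᵥ x) * (x ⬝ᵥ u) * (x ⬝ᵥ x))
        = -(2 / (x ⬝ᵥ x) * (x ⬝ᵥ u)) := by
      field_simp
      ring
    rw [this, neg_smul, sub_neg_eq_add, sub_add_cancel]

/-- The action `(v, b) ↦ (O v, O b Oᵀ)` of a matrix on the initial data. -/
noncomputable def conjData (O : Matrix (Fin n) (Fin n) ℝ) : InitialData n →ₗ[ℝ] InitialData n where
  toFun p := (WithLp.toLp 2 (O *ᵥ p.1.ofLp), toSym2 (O * symMatrix p.2 * Oᵀ) (by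
    rw [IsSymm, transpose_mul, transpose_mul, transpose_transpose, (symMatrix_isSymm p.2).eq,
      Matrix.mul_assoc]))
  map_add' p q := by
    refine Prod.ext ?_ (funext fun z => ?_)
    · ext i
      simp [mulVec_add]
    · induction z using Sym2.ind with
      | _ i j =>
        have e : symMatrix (p + q).2 = symMatrix p.2 + symMatrix q.2 := rfl
        change (O * symMatrix (p + q).2 * Oᵀ) i j
          = (O * symMatrix p.2 * Oᵀ) i j + (O * symMatrix q.2 * Oᵀ) i j
        rw [e, Matrix.mul_add, Matrix.add_mul, Matrix.add_apply]
  map_smul' c p := by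
    refine Prod.ext ?_ (funext fun z => ?_)
    · ext i
      simp [mulVec_smul]
    · induction z using Sym2.ind with
      | _ i j =>
        have e : symMatrix (c • p).2 = c • symMatrix p.2 := rfl
        change (O * symMatrix (c • p).2 * Oᵀ) i j = c * (O * symMatrix p.2 * Oᵀ) i j
        rw [e, Matrix.mul_smul, Matrix.smul_mul, Matrix.smul_apply, smul_eq_mul]

theorem conjData_fst (O : Matrix (Fin n) (Fin n) ℝ) (p : InitialData n) :
    (conjData O p).1.ofLp = O *ᵥ p.1.ofLp := rfl

theorem symMatrix_conjData_snd (O : Matrix (Fin n) (Fin n) ℝ) (p : InitialData n) :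
    symMatrix (conjData O p).2 = O * symMatrix p.2 * Oᵀ := rfl

theorem symMatrix_injective : Function.Injective (symMatrix : (Sym2 (Fin n) → ℝ) → _) := by
  intro b c h
  funext z
  induction z using Sym2.ind with
  | _ i j => exact congrFun (congrFun h i) j

theorem conjData_conjData {O : Matrix (Fin n) (Fin n) ℝ} (hO : O * O = 1) (hOt : Oᵀ = O)
    (p : InitialData n) : conjData O (conjData O p) = p := by
  refine Prod.ext ?_ (symMatrix_injective ?_)
  · apply WithLp.ofLp_injective
    rw [conjData_fst, conjData_fst, mulVec_mulVec, hO, one_mulVec]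
  · rw [symMatrix_conjData_snd, symMatrix_conjData_snd, hOt, ← Matrix.mul_assoc,
      ← Matrix.mul_assoc, hO, Matrix.one_mul, Matrix.mul_assoc, hO, Matrix.mul_one]

theorem det_conjData_ne_zero {O : Matrix (Fin n) (Fin n) ℝ} (hO : O * O = 1) (hOt : Oᵀ = O) :
    LinearMap.det (conjData O) ≠ 0 := by
  intro h
  have e : conjData O ∘ₗ conjData O = LinearMap.id :=
    LinearMap.ext fun p => conjData_conjData hO hOt p
  have := congrArg LinearMap.det e
  rw [LinearMap.det_comp, h, LinearMap.det_id, zero_mul] at this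
  exact zero_ne_one this

/-- The fundamental solution `Y` of the initial data `p` at time `t`. -/
noncomputable def dataY (p : InitialData n) (t : ℝ) : Matrix (Fin n) (Fin n) ℝ :=
  fundY p.1.ofLp (symMatrix p.2) t

theorem dataY_zero (p : InitialData n) : dataY p 0 = 1 := fundY_zero _ _

theorem continuous_dataY : Continuous fun q : InitialData n × ℝ => dataY q.1 q.2 := by
  have hv : Continuous fun q : InitialData n × ℝ => q.1.1.ofLp :=
    (PiLp.continuous_ofLp 2 _).comp (continuous_fst.comp continuous_fst)
  have hb : Continuous fun q : InitialData n × ℝ => symMatrix q.1.2 :=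
    continuous_symMatrix.comp (continuous_snd.comp continuous_fst)
  have hC : Continuous fun q : InitialData n × ℝ => invariant q.1.1.ofLp (symMatrix q.1.2) :=
    (hb.mul hb).sub (hv.matrix_vecMulVec hv)
  have hF : Continuous fun q : InitialData n × ℝ =>
      linFlow (invariant q.1.1.ofLp (symMatrix q.1.2)) q.2 :=
    NormedSpace.exp_continuous.comp (continuous_snd.smul
      (Continuous.matrix_fromBlocks continuous_const continuous_const hC continuous_const))
  refine Continuous.sub ?_ (Continuous.mul ?_ hb)
  · exact continuous_pi fun i => continuous_pi fun j => hF.matrix_elem (Sum.inl i) (Sum.inl j)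
  · exact continuous_pi fun i => continuous_pi fun j => hF.matrix_elem (Sum.inl i) (Sum.inr j)

theorem linFlow_conj {O : Matrix (Fin n) (Fin n) ℝ} (hO : O * O = 1)
    (C : Matrix (Fin n) (Fin n) ℝ) (t : ℝ) :
    linFlow (O * C * O) t = fromBlocks O 0 0 O * linFlow C t * fromBlocks O 0 0 O := by
  have hD : fromBlocks O 0 0 O * fromBlocks O 0 0 O = 1 := by
    rw [fromBlocks_multiply]
    simp [hO, fromBlocks_one]
  have hDi : (fromBlocks O 0 0 O)⁻¹ = fromBlocks O 0 0 O := inv_eq_right_inv hD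
  have hU : IsUnit (fromBlocks O 0 0 O) := IsUnit.of_mul_eq_one _ hD
  have := Matrix.exp_conj (fromBlocks O 0 0 O) (t • fromBlocks 0 1 C 0) hU
  rw [hDi] at this
  rw [linFlow, linFlow, ← this, Matrix.mul_smul, Matrix.smul_mul, fromBlocks_multiply,
    fromBlocks_multiply]
  simp [hO]

theorem dataY_conjData {O : Matrix (Fin n) (Fin n) ℝ} (hO : O * O = 1) (hOt : Oᵀ = O)
    (p : InitialData n) (t : ℝ) : dataY (conjData O p) t = O * dataY p t * O := by
  have hC : invariant (conjData O p).1.ofLp (symMatrix (conjData O p).2)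
      = O * invariant p.1.ofLp (symMatrix p.2) * O := by
    rw [invariant, invariant, conjData_fst, symMatrix_conjData_snd, hOt, Matrix.mul_sub,
      Matrix.sub_mul, mul_vecMulVec, vecMulVec_mul, ← mulVec_transpose, hOt]
    congr 1
    calc O * symMatrix p.2 * O * (O * symMatrix p.2 * O)
        = O * symMatrix p.2 * (O * O) * symMatrix p.2 * O := by simp only [Matrix.mul_assoc]
      _ = O * (symMatrix p.2 * symMatrix p.2) * O := by
          rw [hO, Matrix.mul_one]; simp only [Matrix.mul_assoc]
  rw [dataY, fundY, hC, linFlow_conj hO, symMatrix_conjData_snd, hOt, dataY, fundY]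
  rw [← fromBlocks_toBlocks (linFlow (invariant p.1.ofLp (symMatrix p.2)) t),
    fromBlocks_multiply, fromBlocks_multiply]
  simp only [toBlocks_fromBlocks₁₁, toBlocks_fromBlocks₁₂, Matrix.zero_mul, Matrix.mul_zero,
    add_zero, zero_add]
  set A := (linFlow (invariant p.1.ofLp (symMatrix p.2)) t).toBlocks₁₁
  set B := (linFlow (invariant p.1.ofLp (symMatrix p.2)) t).toBlocks₁₂
  rw [Matrix.mul_sub, Matrix.sub_mul]
  congr 1
  calc O * B * O * (O * symMatrix p.2 * O) = O * B * (O * O) * symMatrix p.2 * O := by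
        simp only [Matrix.mul_assoc]
    _ = O * (B * symMatrix p.2) * O := by
        rw [hO, Matrix.mul_one]; simp only [Matrix.mul_assoc]

/-! ### Blow-up directions with a vanishing entry -/

/-- The singular times of the fundamental solution are isolated. -/
theorem countable_singular_times (p : InitialData n) : {t | (dataY p t).det = 0}.Countable := by
  have : DiscreteTopology {t | (dataY p t).det = 0} := by
    rw [discreteTopology_subtype_iff]
    intro t ht
    obtain ⟨δ, -, h⟩ := exists_sign_change (symMatrix_isSymm p.2) ht
    rw [← disjoint_iff, disjoint_principal_right]
    filter_upwards [h] with s hs hs'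
    have hs0 : (fundY p.1.ofLp (symMatrix p.2) s).det = 0 := hs'
    rw [hs0, mul_zero] at hs
    exact lt_irrefl _ hs
  exact Set.countable_coe_iff.mp countable_of_Lindelof_of_discrete

/-- The initial data for which, at some time of `[0, N]`, the kernel of `Yᵀ` contains a nonzero
vector with a vanishing entry. -/
def degenerateData (n : ℕ) (N : ℝ) : Set (InitialData n) :=
  {p | ∃ t ∈ Set.Icc 0 N, ∃ u : Fin n → ℝ, u ≠ 0 ∧ (dataY p t)ᵀ *ᵥ u = 0 ∧ ∏ i, u i = 0}

theorem isClosed_degenerateData (N : ℝ) : IsClosed (degenerateData n N) := by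
  -- Scaled to norm one, the pair `(t, u)` ranges over a compact set.
  let S : Set ((Set.Icc (0 : ℝ) N × Metric.sphere (0 : Fin n → ℝ) 1) × InitialData n) :=
    {q | (dataY q.2 q.1.1)ᵀ *ᵥ (q.1.2 : Fin n → ℝ) = 0 ∧ ∏ i, (q.1.2 : Fin n → ℝ) i = 0}
  have ht : Continuous fun q : (Set.Icc (0 : ℝ) N × Metric.sphere (0 : Fin n → ℝ) 1)
      × InitialData n => (q.1.1 : ℝ) := by fun_prop
  have hu : Continuous fun q : (Set.Icc (0 : ℝ) N × Metric.sphere (0 : Fin n → ℝ) 1)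
      × InitialData n => (q.1.2 : Fin n → ℝ) := by fun_prop
  have hS : IsClosed S := by
    refine (isClosed_eq ((continuous_dataY.comp
      (continuous_snd.prodMk ht)).matrix_transpose.matrix_mulVec hu) continuous_const).inter
      (isClosed_eq (continuous_finsetProd _ fun i _ => (continuous_apply i).comp hu)
        continuous_const)
  have e : degenerateData n N = Prod.snd '' S := by
    ext p
    constructor
    · rintro ⟨t, ht, u, hu0, hker, hprod⟩
      have hnu : ‖u‖ ≠ 0 := norm_ne_zero_iff.mpr hu0
      refine ⟨((⟨t, ht⟩, ⟨‖u‖⁻¹ • u, ?_⟩), p), ⟨?_, ?_⟩, rfl⟩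
      · rw [mem_sphere_zero_iff_norm, norm_smul, norm_inv, norm_norm, inv_mul_cancel₀ hnu]
      · change (dataY p t)ᵀ *ᵥ (‖u‖⁻¹ • u) = 0
        rw [mulVec_smul, hker, smul_zero]
      · change ∏ i, (‖u‖⁻¹ • u) i = 0
        simp only [Pi.smul_apply, smul_eq_mul, Finset.prod_mul_distrib, hprod, mul_zero]
    · rintro ⟨⟨⟨⟨t, ht⟩, ⟨u, hu⟩⟩, q⟩, ⟨hker, hprod⟩, rfl⟩
      refine ⟨t, ht, u, ?_, hker, hprod⟩
      rintro rfl
      simp at hu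
  rw [e]
  exact isClosedMap_snd_of_compactSpace S hS

theorem measurable_reflection_data :
    Measurable fun q : (Fin n → ℝ) × InitialData n => conjData (reflection q.1) q.2 := by
  have hr : ∀ i j, Measurable fun q : (Fin n → ℝ) × InitialData n => reflection q.1 i j := by
    intro i j
    have hx : ∀ k, Measurable fun q : (Fin n → ℝ) × InitialData n => q.1 k := fun k =>
      ((continuous_apply k).comp continuous_fst).measurable
    have hxx : Measurable fun q : (Fin n → ℝ) × InitialData n => q.1 ⬝ᵥ q.1 :=
      Finset.measurable_fun_sum _ fun k _ => (hx k).mul (hx k)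
    exact measurable_const.sub ((measurable_const.div hxx).mul ((hx i).mul (hx j)))
  have hv : ∀ i, Measurable fun q : (Fin n → ℝ) × InitialData n => q.2.1 i := fun i =>
    ((continuous_apply i).comp ((PiLp.continuous_ofLp 2 _).comp
      (continuous_fst.comp continuous_snd))).measurable
  have hb : ∀ i j, Measurable fun q : (Fin n → ℝ) × InitialData n => symMatrix q.2.2 i j :=
    fun i j => ((continuous_apply _).comp (continuous_snd.comp continuous_snd)).measurable
  refine Measurable.prodMk ?_ (measurable_pi_lambda _ fun z => ?_)
  · refine (PiLp.continuous_toLp 2 _).measurable.comp (measurable_pi_lambda _ fun i => ?_)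
    simp only [mulVec, dotProduct]
    exact Finset.measurable_fun_sum _ fun j _ => (hr i j).mul (hv j)
  · induction z using Sym2.ind with
    | _ i j =>
      change Measurable fun q : (Fin n → ℝ) × InitialData n =>
        (reflection q.1 * symMatrix q.2.2 * (reflection q.1)ᵀ) i j
      simp only [mul_apply, transpose_apply]
      exact Finset.measurable_fun_sum _ fun k _ =>
        (Finset.measurable_fun_sum _ fun l _ => (hr i l).mul (hb l k)).mul (hr j k)

/-- For fixed initial data almost every reflection leads out of `degenerateData`: there are
countably many kernel directions, and a random reflection moves each of them to a direction
without vanishing entries. -/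
theorem ae_reflection_notMem (p : InitialData n) (N : ℝ) :
    ∀ᵐ x : Fin n → ℝ, conjData (reflection x) p ∉ degenerateData n N := by
  have hb := symMatrix_isSymm p.2
  have hex : ∀ t : ℝ, (dataY p t).det = 0 → ∃ u : Fin n → ℝ, u ≠ 0 ∧
      ∀ y, (dataY p t)ᵀ *ᵥ y = 0 → ∃ c : ℝ, y = c • u := by
    intro t ht
    obtain ⟨k, u, hku⟩ := exists_kernelPair hb ht
    refine ⟨u, ?_, fun y hy => ⟨_, hku.eq_smul hy⟩⟩
    rintro rfl
    simpa using hku.unit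
  choose! u hu0 hu using hex
  have hae : ∀ᵐ x : Fin n → ℝ, ∀ t ∈ {t | (dataY p t).det = 0}, ∀ i,
      (x ⬝ᵥ x) * u t i - 2 * x i * (x ⬝ᵥ u t) ≠ 0 := by
    refine (ae_ball_iff (countable_singular_times p)).mpr fun t ht => ?_
    exact ae_all_iff.mpr fun i =>
      compl_mem_ae_iff.mpr (volume_reflection_entry_eq_zero (hu0 t ht) i)
  filter_upwards [hae] with x hx hmem
  obtain ⟨t, -, w, hw0, hker, hprod⟩ := hmem
  have hO := reflection_mul_self x
  have hOt := reflection_transpose x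
  rw [dataY_conjData hO hOt, transpose_mul, transpose_mul, hOt] at hker
  set y := reflection x *ᵥ w with hy
  have hwy : w = reflection x *ᵥ y := by rw [hy, mulVec_mulVec, hO, one_mulVec]
  have hyker : (dataY p t)ᵀ *ᵥ y = 0 := by
    have := congrArg (fun z => reflection x *ᵥ z) hker
    simp only [mulVec_zero] at this
    rw [← mulVec_mulVec, ← mulVec_mulVec, mulVec_mulVec, hO, one_mulVec] at this
    exact this
  have hdet : (dataY p t).det = 0 := by
    rw [← det_transpose]
    refine exists_mulVec_eq_zero_iff.mp ⟨y, ?_, hyker⟩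
    rintro hy0
    rw [hy0, mulVec_zero] at hwy
    exact hw0 hwy
  obtain ⟨c, hc⟩ := hu t hdet y hyker
  obtain ⟨i, -, hi⟩ := Finset.prod_eq_zero_iff.mp hprod
  have hc0 : c ≠ 0 := by
    rintro rfl
    rw [hc, zero_smul, mulVec_zero] at hwy
    exact hw0 hwy
  have hxi := hx t hdet i
  have hxx : x ⬝ᵥ x ≠ 0 := by
    intro h0
    have : x = 0 := dotProduct_self_eq_zero.mp h0
    rw [this] at hxi
    simp at hxi
  rw [hwy, hc, reflection_mulVec] at hi
  simp only [Pi.sub_apply, Pi.smul_apply, smul_eq_mul, dotProduct_smul] at hi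
  apply hxi
  have : c * (x ⬝ᵥ x * u t i - 2 * x i * (x ⬝ᵥ u t))
      = (x ⬝ᵥ x) * (c * u t i - 2 / (x ⬝ᵥ x) * (c * (x ⬝ᵥ u t)) * x i) := by
    field_simp
  rw [hi, mul_zero] at this
  exact (mul_eq_zero.mp this).resolve_left hc0

/-- Averaging over the reflections, which preserve null sets, `degenerateData` is null. -/
theorem volume_degenerateData (N : ℝ) : volume (degenerateData n N) = 0 := by
  have hm : MeasurableSet {q : (Fin n → ℝ) × InitialData n |
      conjData (reflection q.1) q.2 ∉ degenerateData n N} :=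
    measurable_reflection_data (isClosed_degenerateData N).isOpen_compl.measurableSet
  have h1 : ∀ᵐ p : InitialData n, ∀ᵐ x : Fin n → ℝ,
      conjData (reflection x) p ∉ degenerateData n N :=
    Eventually.of_forall fun p => ae_reflection_notMem p N
  have h2 := (Measure.ae_ae_comm hm).mpr h1
  obtain ⟨x, hx⟩ := h2.exists
  have hO := reflection_mul_self x
  have hOt := reflection_transpose x
  have h3 : volume (conjData (reflection x) ⁻¹' degenerateData n N) = 0 := by
    have : volume {p | ¬ conjData (reflection x) p ∉ degenerateData n N} = 0 := ae_iff.mp hx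
    simp only [not_not] at this
    exact this
  rw [Measure.addHaar_preimage_linearMap _ (det_conjData_ne_zero hO hOt)] at h3
  refine (mul_eq_zero.mp h3).resolve_left ?_
  simpa using det_conjData_ne_zero hO hOt

end Reflections

section Generic

variable {n : ℕ}

/-! ### Genericity -/

/-- The initial data for which the fundamental solution has a singular time in `(0, N)`. -/
def singularBefore (n : ℕ) (N : ℝ) : Set (InitialData n) :=
  {p | ∃ t ∈ Set.Ioo 0 N, (dataY p t).det = 0}

/-- Singular times are stable under perturbation, because `det Y` changes sign at each of them. -/
theorem isOpen_singularBefore (N : ℝ) : IsOpen (singularBefore n N) := by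
  have hc : Continuous fun q : InitialData n × ℝ => (dataY q.1 q.2).det :=
    continuous_dataY.matrix_det
  have e : singularBefore n N = ⋃ t ∈ Set.Ioo 0 N, {p : InitialData n | (dataY p t).det < 0} := by
    ext p
    simp only [Set.mem_iUnion, Set.mem_ofPred_eq, exists_prop]
    constructor
    · rintro ⟨t, ht, hdet⟩
      obtain ⟨δ, hδ, h⟩ := exists_sign_change (symMatrix_isSymm p.2) hdet
      have hI : Set.Ioo 0 N ∈ 𝓝 t := Ioo_mem_nhds ht.1 ht.2
      rcases lt_or_gt_of_ne hδ with hneg | hpos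
      · have h' : ∀ᶠ s in 𝓝[<] t, 0 < (t - s) * δ * (dataY p s).det :=
          h.filter_mono (nhdsWithin_mono t fun s hs => ne_of_lt hs)
        obtain ⟨s, ⟨hs, hsI⟩, hst⟩ := ((h'.and (mem_nhdsWithin_of_mem_nhds hI)).and
          self_mem_nhdsWithin).exists
        have hts : 0 < t - s := sub_pos.mpr hst
        exact ⟨s, hsI, neg_of_mul_pos_right hs (mul_neg_of_pos_of_neg hts hneg).le⟩
      · have h' : ∀ᶠ s in 𝓝[>] t, 0 < (t - s) * δ * (dataY p s).det :=
          h.filter_mono (nhdsWithin_mono t fun s hs => ne_of_gt hs)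
        obtain ⟨s, ⟨hs, hsI⟩, hst⟩ := ((h'.and (mem_nhdsWithin_of_mem_nhds hI)).and
          self_mem_nhdsWithin).exists
        have hts : t - s < 0 := sub_neg.mpr hst
        exact ⟨s, hsI, neg_of_mul_pos_right hs (mul_neg_of_neg_of_pos hts hpos).le⟩
    · rintro ⟨t, ht, hneg⟩
      have hcp : Continuous fun s => (dataY p s).det :=
        hc.comp (f := fun s : ℝ => (p, s)) (continuous_const.prodMk continuous_id)
      have h0 : (dataY p 0).det = 1 := by rw [dataY_zero, det_one]
      obtain ⟨s, hs, hs0⟩ := intermediate_value_Icc' ht.1.le hcp.continuousOn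
        (⟨hneg.le, by simp only [h0]; exact zero_le_one⟩ : (0 : ℝ) ∈ Set.Icc _ _)
      have hs0' : (dataY p s).det = 0 := hs0
      refine ⟨s, ⟨lt_of_le_of_ne hs.1 ?_, hs.2.trans_lt ht.2⟩, hs0'⟩
      rintro rfl
      rw [h0] at hs0'
      exact one_ne_zero hs0'
  rw [e]
  refine isOpen_biUnion fun t _ => ?_
  have hct : Continuous fun p : InitialData n => (dataY p t).det :=
    hc.comp (f := fun p : InitialData n => (p, t)) (continuous_id.prodMk continuous_const)
  exact isOpen_lt hct continuous_const

/-- The initial data whose first singular time has a kernel direction with a vanishing entry. -/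
def degenerateBlowUp (n : ℕ) : Set (InitialData n) :=
  {p | ∃ t, 0 < t ∧ (∀ s ∈ Set.Ico 0 t, (dataY p s).det ≠ 0) ∧
    ∃ u : Fin n → ℝ, u ≠ 0 ∧ (dataY p t)ᵀ *ᵥ u = 0 ∧ ∏ i, u i = 0}

theorem volume_degenerateBlowUp : volume (degenerateBlowUp n) = 0 := by
  have hsub : degenerateBlowUp n ⊆ ⋃ N : ℕ, degenerateData n N := by
    rintro p ⟨t, ht, -, hu⟩
    obtain ⟨N, hN⟩ := exists_nat_ge t
    exact Set.mem_iUnion.mpr ⟨N, t, ⟨ht.le, hN⟩, hu⟩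
  exact measure_mono_null hsub (measure_iUnion_null fun N => volume_degenerateData N)

theorem singular_of_mulVec_eq_zero {p : InitialData n} {t : ℝ} {u : Fin n → ℝ} (hu : u ≠ 0)
    (h : (dataY p t)ᵀ *ᵥ u = 0) : (dataY p t).det = 0 := by
  rw [← det_transpose]
  exact exists_mulVec_eq_zero_iff.mp ⟨u, hu, h⟩

/-- Within the open set where the first singular time is less than `N`, the degenerate data lie in
the closed null set `degenerateData n N`. -/
theorem degenerateBlowUp_inter_subset (N : ℝ) :
    degenerateBlowUp n ∩ singularBefore n N ⊆ degenerateData n N := by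
  rintro p ⟨⟨t, ht, hfirst, hu⟩, s, hs, hdet⟩
  refine ⟨t, ⟨ht.le, ?_⟩, hu⟩
  by_contra! hlt
  exact hfirst s ⟨hs.1.le, hs.2.trans hlt⟩ hdet

theorem isNowhereDense_degenerateBlowUp : IsNowhereDense (degenerateBlowUp n) := by
  rw [IsNowhereDense, Set.eq_empty_iff_forall_notMem]
  intro p hp
  set U := interior (closure (degenerateBlowUp n)) with hU
  have hUo : IsOpen U := isOpen_interior
  have hUsub : U ⊆ closure (degenerateBlowUp n) := interior_subset
  obtain ⟨q, hqU, hq⟩ := mem_closure_iff.mp (hUsub hp) U hUo hp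
  obtain ⟨t, ht, -, u, hu0, hu, -⟩ := hq
  set G := U ∩ singularBefore n (t + 1) with hG
  have hGo : IsOpen G := hUo.inter (isOpen_singularBefore _)
  have hqG : q ∈ G :=
    ⟨hqU, t, ⟨ht, lt_add_one t⟩, singular_of_mulVec_eq_zero hu0 hu⟩
  have hsub : G ⊆ degenerateData n (t + 1) := by
    intro r hr
    rw [← (isClosed_degenerateData (n := n) (t + 1)).closure_eq]
    refine mem_closure_iff.mpr fun O hO hrO => ?_
    obtain ⟨r', ⟨hr'O, hr'G⟩, hr'⟩ :=
      mem_closure_iff.mp (hUsub hr.1) (O ∩ G) (hO.inter hGo) ⟨hrO, hr⟩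
    exact ⟨r', hr'O, degenerateBlowUp_inter_subset _ ⟨hr', hr'G.2⟩⟩
  have hpos := hGo.measure_pos volume ⟨q, hqG⟩
  exact hpos.ne' (measure_mono_null hsub (volume_degenerateData _))

theorem isNowhereDense_union {X : Type*} [TopologicalSpace X] {s t : Set X}
    (hs : IsNowhereDense s) (ht : IsNowhereDense t) : IsNowhereDense (s ∪ t) := by
  rw [IsNowhereDense, closure_union,
    interior_union_isClosed_of_interior_empty isClosed_closure ht]
  exact hs

/-- Off the two exceptional sets the dichotomy and the convergence of the opinions hold. -/
theorem dichotomy_of_generic (hn : 0 < n) {p : InitialData n}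
    (hk : (krylov p.1.ofLp (symMatrix p.2)).det ≠ 0) (hd : p ∉ degenerateBlowUp n) {T : EReal}
    {V : ℝ → EuclideanSpace ℝ (Fin n)} {W : ℝ → Matrix (Fin n) (Fin n) ℝ}
    (h : IsMaximalSolution p.1 (symMatrix p.2) T V W) :
    (StrictBalance T W ∨ OpinionsVanish T V) ∧
      (StrictBalance T W → NormalizedOpinionConverges T V) := by
  have hb := symMatrix_isSymm p.2
  induction T with
  | bot => exact absurd h.pos not_lt_bot
  | top =>
    refine ⟨Or.inr (h.isSolution.opinionsVanish hb), fun hbal => ?_⟩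
    obtain ⟨μ, x, hx0, hx, hvx⟩ := h.isSolution.exists_eigenvector_of_strictBalance hb hn hbal
    exact absurd (det_krylov_eq_zero hb hx0 hx hvx) hk
  | coe τ =>
    have hτ : 0 < τ := EReal.coe_pos.mp h.pos
    obtain ⟨k, u, hku⟩ := exists_kernelPair hb (h.det_fundY_eq_zero hb)
    have hu0 : u ≠ 0 := by
      rintro rfl
      simpa using hku.unit
    have hu : ∀ i, u i ≠ 0 := by
      intro i hi
      exact hd ⟨τ, hτ, fun s hs => h.isSolution.det_fundY_ne_zero hb
        ⟨hs.1, EReal.coe_lt_coe_iff.mpr hs.2⟩, u, hu0, hku.transpose_mulVec,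
        Finset.prod_eq_zero (Finset.mem_univ i) hi⟩
    exact ⟨Or.inl (h.isSolution.strictBalance hτ hb hku hu),
      fun _ => h.isSolution.normalizedOpinionConverges hτ hb hku⟩

end Generic

end CoEvolution

theorem mainTheorem1 (n : ℕ) (hn : 0 < n) :
    CoEvolution.ForGenericData fun p : CoEvolution.InitialData n =>
      ∀ (T : EReal) (V : ℝ → EuclideanSpace ℝ (Fin n)) (W : ℝ → Matrix (Fin n) (Fin n) ℝ),
        CoEvolution.IsMaximalSolution p.1 (CoEvolution.symMatrix p.2) T V W →
          (CoEvolution.StrictBalance T W ∨ CoEvolution.OpinionsVanish T V) ∧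
          (CoEvolution.StrictBalance T W → CoEvolution.NormalizedOpinionConverges T V) := by
  have hsub : {p : CoEvolution.InitialData n | ¬ ∀ (T : EReal)
      (V : ℝ → EuclideanSpace ℝ (Fin n)) (W : ℝ → Matrix (Fin n) (Fin n) ℝ),
        CoEvolution.IsMaximalSolution p.1 (CoEvolution.symMatrix p.2) T V W →
          (CoEvolution.StrictBalance T W ∨ CoEvolution.OpinionsVanish T V) ∧
          (CoEvolution.StrictBalance T W → CoEvolution.NormalizedOpinionConverges T V)}
      ⊆ {p | (CoEvolution.krylov p.1.ofLp (CoEvolution.symMatrix p.2)).det = 0}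
        ∪ CoEvolution.degenerateBlowUp n := by
    intro p hp
    by_contra hnot
    rw [Set.mem_union, not_or] at hnot
    exact hp fun T V W h => CoEvolution.dichotomy_of_generic hn hnot.1 hnot.2 h
  have hnull := CoEvolution.volume_det_krylov_eq_zero (n := n)
  refine ⟨.mono hsub (CoEvolution.isNowhereDense_union (.of_isClosed_null
    (isClosed_eq CoEvolution.continuous_det_krylov_data continuous_const) hnull)
    CoEvolution.isNowhereDense_degenerateBlowUp), ?_⟩
  exact measure_mono_null hsub
    (measure_union_null hnull CoEvolution.volume_degenerateBlowUp)
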